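/- All formulas are finite sets of clauses in conjunctive normal form (CNF), and a clause is a finite set of literals over countably many variables. A formula is minimal unsatisfiable if it is unsatisfiable and each of its proper subsets is satisfiable; its deficiency is the number of its clauses minus the number of variables that occur in it; $\mathrm{MU}(1)$ is the class of minimal unsatisfiable formulas of deficiency $1$. A variable-read-once (Var-ROR) refutation of $\Phi$ is a finite sequence of resolution steps $(\alpha\vee x),(\neg x\vee\beta)\vdash(\alpha\vee\beta)$, each with parents among the clauses of $\Phi$ and the resolvents of earlier steps, that derives the empty clause and in which every variable is used at most once as the matching variable $x$ (the sequence may be empty if $\Phi$ contains the empty clause). Let $\Phi$ be minimal unsatisfiable with clauses $x\vee\pi_1,\dots,x\vee\pi_r$, $\neg x\vee\phi_1,\dots,\neg x\vee\phi_q$ and clauses $\sigma_1,\dots,\sigma_t$ in which the variable $x$ does not occur. A variable-disjunctive splitting of $\Phi$ over a variable $x$ of $\Phi$ is a pair of minimal unsatisfiable formulas $F_x=\{\pi_1,\dots,\pi_r\}\cup S$, $F_{\neg x}=\{\phi_1,\dots,\phi_q\}\cup T$ with $S,T\subseteq\{\sigma_1,\dots,\sigma_t\}$, $S\cap T=\emptyset$,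 such that no variable occurs in both $F_x$ and $F_{\neg x}$. A complete variable-disjunctive splitting tree of $\Phi$ is a finite binary tree, labelled with minimal unsatisfiable formulas, with root $\Phi$, in which each inner node is a formula with at least two variables whose two children form a variable-disjunctive splitting of it over a variable recorded at that node, and in which each leaf is a formula with at most one variable. Then: 1. Every $\Phi\in\mathrm{MU}(1)$ has a Var-ROR refutation, and it has a complete variable-disjunctive splitting tree. 2. There is a polynomial-time algorithm that, given any $\Phi\in\mathrm{MU}(1)$, computes a Var-ROR refutation of $\Phi$. 3. There is a polynomial-time algorithm that, given any complete variable-disjunctive splitting tree of any $\Phi\in\mathrm{MU}(1)$ (with the formulas at its nodes), computes a Var-ROR refutation of $\Phi$, in time polynomial in the size of the tree. -/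

import Mathlib

namespace ReadOnce

/-! ### Formulas in conjunctive normal form -/

/-- A literal over the variables `0, 1, 2, …`: `(x, true)` is `x` and `(x, false)` is `¬ x`. -/
abbrev Literal := ℕ × Bool

/-- A clause is the disjunction of a finite set of literals; `∅` is the empty clause. -/
abbrev Clause := Finset Literal

/-- A formula in CNF is a finite set of clauses. A sub-formula is a subset. -/
abbrev CNF := Finset Clause

/-- The variables that occur in a formula. -/
def vars (Φ : CNF) : Finset ℕ :=
  Φ.biUnion fun C => C.image Prod.fst

/-- The truth assignment `ν` satisfies every clause of `Φ`. -/
def Satisfies (ν : ℕ → Bool) (Φ : CNF) : Prop :=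
  ∀ C ∈ Φ, ∃ l ∈ C, ν l.1 = l.2

def Satisfiable (Φ : CNF) : Prop :=
  ∃ ν : ℕ → Bool, Satisfies ν Φ

/-- `Φ` is minimal unsatisfiable: it is unsatisfiable, every proper sub-formula is satisfiable. -/
def IsMU (Φ : CNF) : Prop :=
  ¬ Satisfiable Φ ∧ ∀ Ψ : CNF, Ψ ⊂ Φ → Satisfiable Ψ

/-- The deficiency: the number of clauses minus the number of variables. -/
def deficiency (Φ : CNF) : ℤ :=
  (Φ.card : ℤ) - ((vars Φ).card : ℤ)

/-- `Φ` belongs to the class `MU(k)`. -/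
def IsMUOfDeficiency (k : ℤ) (Φ : CNF) : Prop :=
  IsMU Φ ∧ deficiency Φ = k

/-! ### Resolution -/

/-- A resolution step: two parent clauses and the matching variable. -/
structure ResStep where
  pivot : ℕ
  left : Clause
  right : Clause

/-- The clause `α ∨ β`, for the parents `α ∨ x` and `¬ x ∨ β`. -/
def ResStep.resolvent (s : ResStep) : Clause :=
  s.left.erase (s.pivot, true) ∪ s.right.erase (s.pivot, false)

/-- The step `s` can be carried out when the clauses of `Φ` are available. -/
def ResStep.Valid (s : ResStep) (Φ : CNF) : Prop :=
  s.left ∈ Φ ∧ s.right ∈ Φ ∧ (s.pivot, true) ∈ s.left ∧ (s.pivot, false) ∈ s.right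

/-- The list of steps is a resolution derivation from `Φ` of a set of clauses that contains `π`:
every parent is a clause of `Φ` or the resolvent of an earlier step, and so is `π`. -/
def Derives : CNF → List ResStep → Clause → Prop
  | Φ, [], π => π ∈ Φ
  | Φ, s :: R, π => s.Valid Φ ∧ Derives (insert s.resolvent Φ) R π

/-- A variable-read-once resolution refutation of `Φ`: a resolution derivation of the empty clause
in which every variable is used at most once as a matching variable. -/
def IsVarRORRefutation (Φ : CNF) (R : List ResStep) : Prop :=
  Derives Φ R ∅ ∧ (R.map ResStep.pivot).Nodup

/-- The class Var-ROR. -/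
def VarROR (Φ : CNF) : Prop :=
  ∃ R : List ResStep, IsVarRORRefutation Φ R

/-! ### Splittings and splitting trees -/

/-- The clauses `σ` of `Φ` in which neither `x` nor `¬ x` occurs. -/
def sigma (Φ : CNF) (x : ℕ) : CNF :=
  Φ.filter fun C => (x, true) ∉ C ∧ (x, false) ∉ C

/-- The clauses `π` such that `l ∨ π` is a clause of `Φ` that contains the literal `l`. -/
def stripped (Φ : CNF) (l : Literal) : CNF :=
  (Φ.filter fun C => l ∈ C).image fun C => C.erase l

/-- `(F, G)` is a splitting of the minimal unsatisfiable formula `Φ` over its variable `x`, where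
`S` and `T` are the sets of clauses without `x` that are put into `F` and into `G`. -/
def IsSplitting (Φ : CNF) (x : ℕ) (S T F G : CNF) : Prop :=
  IsMU Φ ∧ x ∈ vars Φ ∧ S ⊆ sigma Φ x ∧ T ⊆ sigma Φ x ∧
    F = stripped Φ (x, true) ∪ S ∧ G = stripped Φ (x, false) ∪ T ∧ IsMU F ∧ IsMU G

/-- `(F, G)` is a variable-disjunctive splitting of `Φ` over `x`. -/
def IsVarDisjunctiveSplitting (Φ : CNF) (x : ℕ) (F G : CNF) : Prop :=
  ∃ S T : CNF, IsSplitting Φ x S T F G ∧ Disjoint S T ∧ Disjoint (vars F) (vars G)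

/-- Binary trees whose nodes carry a formula and whose inner nodes carry also the variable over
which the formula is split. -/
inductive SplitTree where
  | leaf (Φ : CNF) : SplitTree
  | node (Φ : CNF) (x : ℕ) (left right : SplitTree) : SplitTree

/-- The formula at the root. -/
def SplitTree.root : SplitTree → CNF
  | .leaf Φ => Φ
  | .node Φ _ _ _ => Φ

/-- The tree is a variable-disjunctive splitting tree: the formula at an inner node contains more
than one variable, and the formulas of its two children are a variable-disjunctive splitting. -/
def SplitTree.IsVarDisjunctive : SplitTree → Prop
  | .leaf Φ => IsMU Φ
  | .node Φ x l r => 1 < (vars Φ).card ∧ IsVarDisjunctiveSplitting Φ x l.root r.root ∧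
      l.IsVarDisjunctive ∧ r.IsVarDisjunctive

/-- The formula at each leaf contains at most one variable. -/
def SplitTree.IsComplete : SplitTree → Prop
  | .leaf Φ => (vars Φ).card ≤ 1
  | .node _ _ l r => l.IsComplete ∧ r.IsComplete

/-- `T` is a complete variable-disjunctive splitting tree of `Φ`. -/
def IsCompleteVarDisjunctiveTree (Φ : CNF) (T : SplitTree) : Prop :=
  T.root = Φ ∧ T.IsVarDisjunctive ∧ T.IsComplete

/-! ### A machine model with a step count

Data are binary trees, as in the language Lisp with a single atom. Programs are first-order
programs with pairing, branching and loops. Each elementary operation, each test and each copy is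
charged the sizes of the data that it reads and writes, so that a Turing machine can simulate a
run within a polynomial of its cost, and conversely. -/

inductive Data where
  | nil : Data
  | cons (a b : Data) : Data

/-- The number of nodes. -/
def Data.size : Data → ℕ
  | .nil => 1
  | .cons a b => a.size + b.size + 1

/-- The two components, which are `nil` for an atom. -/
def Data.hd : Data → Data
  | .nil => .nil
  | .cons a _ => a

def Data.tl : Data → Data
  | .nil => .nil
  | .cons _ b => b

/-- The truth values: `nil` is false; the tests of programs read anything else as true. -/
def Data.ofBool : Bool → Data
  | false => .nil
  | true => .cons .nil .nil

inductive Prog where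
  /-- return the input -/
  | id : Prog
  /-- return the atom -/
  | nil : Prog
  /-- return the first component of the input -/
  | hd : Prog
  /-- return the second component of the input -/
  | tl : Prog
  /-- compare the two components of the input -/
  | eq : Prog
  /-- run `f`, then run `g` on the result -/
  | comp (f g : Prog) : Prog
  /-- run `f` and `g` on the input and pair the results -/
  | pair (f g : Prog) : Prog
  /-- run `f` or `g` on the input, according to the result of `c` -/
  | ite (c f g : Prog) : Prog
  /-- while `c` returns true on the current datum, replace this datum by the result of `f` -/
  | loop (c f : Prog) : Prog

/-- `P.Run d e t`: the program `P`, run on `d`, halts with the result `e`, at cost `t`. -/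
inductive Prog.Run : Prog → Data → Data → ℕ → Prop
  | id (d : Data) : Run .id d d (d.size + d.size)
  | nil (d : Data) : Run .nil d .nil (d.size + 1)
  | hd (d : Data) : Run .hd d d.hd (d.size + d.hd.size)
  | tl (d : Data) : Run .tl d d.tl (d.size + d.tl.size)
  | eq_true (d : Data) : d.hd = d.tl →
      Run .eq d (.ofBool true) (d.size + (Data.ofBool true).size)
  | eq_false (d : Data) : d.hd ≠ d.tl →
      Run .eq d (.ofBool false) (d.size + (Data.ofBool false).size)
  | comp {f g : Prog} {d e r : Data} {s t : ℕ} : Run f d e s → Run g e r t →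
      Run (.comp f g) d r (s + t + 1)
  | pair {f g : Prog} {d a b : Data} {s t : ℕ} : Run f d a s → Run g d b t →
      Run (.pair f g) d (.cons a b) (s + t + d.size + (Data.cons a b).size)
  | ite_true {c f g : Prog} {d b e : Data} {s t : ℕ} : Run c d b s → b ≠ .nil → Run f d e t →
      Run (.ite c f g) d e (s + t + d.size + b.size)
  | ite_false {c f g : Prog} {d e : Data} {s t : ℕ} : Run c d .nil s → Run g d e t →
      Run (.ite c f g) d e (s + t + d.size + 1)
  | loop_stop {c f : Prog} {d : Data} {s : ℕ} : Run c d .nil s →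
      Run (.loop c f) d d (s + d.size + 1)
  | loop_step {c f : Prog} {d b e r : Data} {s t u : ℕ} : Run c d b s → b ≠ .nil → Run f d e t →
      Run (.loop c f) e r u → Run (.loop c f) d r (s + t + u + d.size + b.size)

/-- Given a representation of inputs and one of outputs by data, a single program finds for each
representation of an input in the domain `Dom` a representation of a solution, at a cost that is
bounded by a polynomial in the size of the representation of the input. -/
def SolvableInPolyTime {α β : Type} (repIn : Data → α → Prop) (repOut : Data → β → Prop)
    (Dom : α → Prop) (Sol : α → β → Prop) : Prop :=
  ∃ (P : Prog) (p : Polynomial ℕ), ∀ (d : Data) (a : α), repIn d a → Dom a →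
    ∃ (e : Data) (t : ℕ), P.Run d e t ∧ t ≤ p.eval d.size ∧ ∃ b : β, repOut e b ∧ Sol a b

/-! ### Representation of the objects by data -/

/-- A finite sequence is represented by the nested pairs of representations of its entries. -/
def RepList {α : Type} (rep : Data → α → Prop) : Data → List α → Prop
  | .nil, [] => True
  | .cons d e, a :: l => rep d a ∧ RepList rep e l
  | _, _ => False

def RepBool (d : Data) (b : Bool) : Prop :=
  d = Data.ofBool b

/-- Variables are written in binary. -/
def RepVar (d : Data) (x : ℕ) : Prop :=
  RepList RepBool d x.bits

def RepLiteral (d : Data) (l : Literal) : Prop :=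
  ∃ a b : Data, d = .cons a b ∧ RepVar a l.1 ∧ RepBool b l.2

/-- A clause is written as a list of its literals, in any order; a literal may be repeated. -/
def RepClause (d : Data) (C : Clause) : Prop :=
  ∃ L : List Literal, L.toFinset = C ∧ RepList RepLiteral d L

/-- A formula is written as a list of its clauses, in any order, each clause once. -/
def RepCNF (d : Data) (Φ : CNF) : Prop :=
  ∃ L : List Clause, L.Nodup ∧ L.toFinset = Φ ∧ RepList RepClause d L

/-- A step is written with its matching variable, its parents and its resolvent. -/
def RepStep (d : Data) (s : ResStep) : Prop :=
  ∃ x a b c : Data, d = .cons x (.cons a (.cons b c)) ∧ RepVar x s.pivot ∧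
    RepClause a s.left ∧ RepClause b s.right ∧ RepClause c s.resolvent

def RepDerivation (d : Data) (R : List ResStep) : Prop :=
  RepList RepStep d R

def RepTree (d : Data) : SplitTree → Prop
  | .leaf Φ => ∃ a : Data, d = .cons .nil a ∧ RepCNF a Φ
  | .node Φ x l r => ∃ y a b c : Data, d = .cons (.cons y a) (.cons b c) ∧
      RepVar y x ∧ RepCNF a Φ ∧ RepTree b l ∧ RepTree c r

end ReadOnce

namespace ReadOnce

/-! ### Satisfiability and occurrences of variables -/

/-! In a minimal unsatisfiable formula every proper sub-formula has smaller deficiency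
(`IsMU.deficiency_lt`). Otherwise Hall's theorem would extend an assignment satisfying a suitable
proper sub-formula to the whole formula, giving each remaining clause a variable of its own. In
deficiency 1, a proper sub-formula therefore has at most as many clauses as variables; call a set of
clauses tight when the two numbers agree.

The core is `exists_occursOnce`: a formula of MU(1) that has a variable has one that occurs exactly
once in each sign. Split over any variable x. Counting (`IsHalf.tight`) shows that both halves are
again in MU(1), and that they share only x and the variables of their common clauses, which form a
tight set. Plain induction could return one of the shared variables, so `exists_occursOnce_of_tight`
proves more: the variable can be found outside any tight set that does not use all variables.

Resolving on such a variable and discarding both parents stays in MU(1) and removes exactly that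
variable. Iteration ends at the formula whose only clause is empty, and no variable is resolved
twice; this is the refutation. The same eliminations, undone one by one, yield a variable x such
that the other variables fall into two classes and every clause respects one side
(`exists_separation`). The two sides form a variable-disjunctive splitting within MU(1), and
recursion builds the tree.

The algorithm is greedy. It runs through all literals of the input, as many rounds as there are
clauses, and eliminates a variable whenever it occurs once in each sign. A round removes at least
one variable as long as any is left, and the stored formula never grows, so the cost is polynomial.
For a splitting tree the same procedure runs on the root formula, which is part of the tree's
representation. -/

def clauseVars (C : Clause) : Finset ℕ :=
  C.image Prod.fst

theorem mem_clauseVars {C : Clause} {x : ℕ} : x ∈ clauseVars C ↔ ∃ b, (x, b) ∈ C := by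
  simp [clauseVars]

theorem mem_vars {Φ : CNF} {x : ℕ} : x ∈ vars Φ ↔ ∃ C ∈ Φ, ∃ b, (x, b) ∈ C := by
  simp [vars]

theorem vars_mono {Φ Ψ : CNF} (h : Φ ⊆ Ψ) : vars Φ ⊆ vars Ψ :=
  Finset.biUnion_subset_biUnion_of_subset_left _ h

theorem vars_union (Φ Ψ : CNF) : vars (Φ ∪ Ψ) = vars Φ ∪ vars Ψ :=
  Finset.union_biUnion

theorem Satisfies.mono {ν : ℕ → Bool} {Φ Ψ : CNF} (h : Satisfies ν Φ) (hs : Ψ ⊆ Φ) :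
    Satisfies ν Ψ :=
  fun C hC => h C (hs hC)

theorem exists_minimal_subset {α : Type*} [DecidableEq α] {P : Finset α → Prop} {s : Finset α}
    (h : P s) : ∃ t ⊆ s, P t ∧ ∀ u ⊂ t, ¬ P u := by
  induction s using Finset.strongInduction with
  | H s ih =>
    by_cases hs : ∃ u ⊂ s, P u
    · obtain ⟨u, hu, hP⟩ := hs
      obtain ⟨t, ht, h1, h2⟩ := ih u hu hP
      exact ⟨t, ht.trans hu.1, h1, h2⟩
    · push Not at hs
      exact ⟨s, subset_rfl, h, hs⟩

theorem IsMU.satisfiable_erase {Φ : CNF} (h : IsMU Φ) {C : Clause} (hC : C ∈ Φ) :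
    Satisfiable (Φ.erase C) :=
  h.2 _ (Finset.erase_ssubset hC)

theorem IsMU.eq_of_subset {Φ Ψ : CNF} (h : IsMU Φ) (hs : Ψ ⊆ Φ) (hu : ¬ Satisfiable Ψ) : Ψ = Φ := by
  by_contra hne
  exact hu (h.2 Ψ (hs.ssubset_of_ne hne))

theorem IsMU.not_tautology {Φ : CNF} (h : IsMU Φ) {C : Clause} (hC : C ∈ Φ) {x : ℕ}
    (ht : (x, true) ∈ C) : (x, false) ∉ C := by
  intro hf
  obtain ⟨ν, hν⟩ := h.satisfiable_erase hC
  refine h.1 ⟨ν, fun D hD => ?_⟩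
  by_cases hDC : D = C
  · subst hDC
    cases hx : ν x
    · exact ⟨_, hf, hx⟩
    · exact ⟨_, ht, hx⟩
  · exact hν D (Finset.mem_erase.2 ⟨hDC, hD⟩)

theorem IsMU.not_mem_of_mem {Φ : CNF} (h : IsMU Φ) {C : Clause} (hC : C ∈ Φ) {x : ℕ} {b : Bool}
    (hb : (x, b) ∈ C) : (x, !b) ∉ C := by
  cases b
  · exact fun ht => h.not_tautology hC ht hb
  · exact h.not_tautology hC hb

/-- No pure literals: if `x` occurred only with sign `!b`, a clause containing it could be removed,
the rest satisfied, and `x` then set to `!b`, which satisfies all of `Φ`. -/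
theorem IsMU.exists_mem {Φ : CNF} (h : IsMU Φ) {x : ℕ} (hx : x ∈ vars Φ) (b : Bool) :
    ∃ C ∈ Φ, (x, b) ∈ C := by
  by_contra hne
  push Not at hne
  obtain ⟨C, hC, c, hc⟩ := mem_vars.1 hx
  obtain ⟨ν, hν⟩ := h.satisfiable_erase hC
  have hb : c = !b := by
    by_contra hcb
    have : c = b := by cases b <;> cases c <;> simp_all
    exact hne C hC (this ▸ hc)
  subst hb
  refine h.1 ⟨Function.update ν x (!b), fun D hD => ?_⟩
  by_cases hDx : (x, !b) ∈ D
  · exact ⟨_, hDx, by simp⟩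
  · obtain ⟨l, hl, hv⟩ := hν D (Finset.mem_erase.2 ⟨fun e => hDx (e ▸ hc), hD⟩)
    refine ⟨l, hl, ?_⟩
    have : l.1 ≠ x := by
      rintro rfl
      by_cases hlb : l.2 = b
      · exact hne D hD (hlb ▸ hl)
      · have : l.2 = !b := by cases b <;> cases h : l.2 <;> simp_all
        exact hDx (this ▸ hl)
    rw [Function.update_of_ne this, hv]

/-! ### Deficiency of sub-formulas -/

/-- If the clauses outside `Ψ` satisfy Hall's condition for the variables outside `Ψ`, then every
assignment that satisfies `Ψ` can be changed outside the variables of `Ψ` to satisfy `Φ`. -/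
theorem satisfiable_of_hall {Φ Ψ : CNF} (hsat : Satisfiable Ψ)
    (hall : ∀ X ⊆ Φ \ Ψ, X.card ≤ (vars X \ vars Ψ).card) : Satisfiable Φ := by
  classical
  obtain ⟨μ, hμ⟩ := hsat
  have hH := (Finset.all_card_le_biUnion_card_iff_exists_injective
    (fun C : {C // C ∈ Φ \ Ψ} => clauseVars C.1 \ vars Ψ)).1 (by
      intro s
      have h1 := hall (s.map (Function.Embedding.subtype _)) (by
        intro C hC
        obtain ⟨D, _, rfl⟩ := Finset.mem_map.1 hC
        exact D.2)
      rw [Finset.card_map] at h1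
      refine h1.trans (Finset.card_le_card ?_)
      intro x hx
      obtain ⟨hx1, hx2⟩ := Finset.mem_sdiff.1 hx
      obtain ⟨C, hC, b, hb⟩ := mem_vars.1 hx1
      obtain ⟨D, hD, rfl⟩ := Finset.mem_map.1 hC
      exact Finset.mem_biUnion.2 ⟨D, hD, Finset.mem_sdiff.2 ⟨mem_clauseVars.2 ⟨b, hb⟩, hx2⟩⟩)
  obtain ⟨f, hinj, hf⟩ := hH
  have hs : ∀ C : {C // C ∈ Φ \ Ψ}, ∃ b, (f C, b) ∈ C.1 := fun C =>
    mem_clauseVars.1 (Finset.mem_sdiff.1 (hf C)).1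
  choose s hs using hs
  -- The matched variable `f C` is set to the sign it has in `C`. All other variables, including
  -- those of `Ψ`, keep their value under `μ`.
  refine ⟨fun x => if h : ∃ C, f C = x then s h.choose else μ x, fun C hC => ?_⟩
  by_cases hCΨ : C ∈ Ψ
  · obtain ⟨l, hl, hv⟩ := hμ C hCΨ
    refine ⟨l, hl, ?_⟩
    refine (dif_neg ?_).trans hv
    rintro ⟨D, hD⟩
    exact (Finset.mem_sdiff.1 (hf D)).2 (hD ▸ mem_vars.2 ⟨C, hCΨ, l.2, hl⟩)
  · let C' : {C // C ∈ Φ \ Ψ} := ⟨C, Finset.mem_sdiff.2 ⟨hC, hCΨ⟩⟩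
    refine ⟨_, hs C', ?_⟩
    have h : ∃ D, f D = f C' := ⟨C', rfl⟩
    refine (dif_pos h).trans ?_
    rw [hinj h.choose_spec]

theorem IsMU.deficiency_lt {Φ Ψ : CNF} (h : IsMU Φ) (hs : Ψ ⊂ Φ) :
    deficiency Ψ < deficiency Φ := by
  by_contra hlt
  push Not at hlt
  -- If the claim fails, a proper sub-formula `M` of maximal deficiency is maximal among all
  -- sub-formulas. Adding clauses to `M` then brings at least as many new variables, which is Hall's
  -- condition.
  obtain ⟨M, hM, hmax⟩ := Finset.exists_max_image Φ.ssubsets deficiency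
    ⟨Ψ, Finset.mem_ssubsets.2 hs⟩
  rw [Finset.mem_ssubsets] at hM
  have hmax' : ∀ X ⊆ Φ, deficiency X ≤ deficiency M := by
    intro X hX
    by_cases hXΦ : X = Φ
    · subst hXΦ
      exact hlt.trans (hmax Ψ (Finset.mem_ssubsets.2 hs))
    · exact hmax X (Finset.mem_ssubsets.2 (hX.ssubset_of_ne hXΦ))
  refine h.1 (satisfiable_of_hall (h.2 M hM) fun X hX => ?_)
  have h1 := hmax' (M ∪ X) (Finset.union_subset hM.1 (hX.trans Finset.sdiff_subset))
  have hd : Disjoint M X := by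
    rw [Finset.disjoint_left]
    exact fun C hC hCX => (Finset.mem_sdiff.1 (hX hCX)).2 hC
  have h2 : (vars M ∪ vars X).card = (vars M).card + (vars X \ vars M).card := by
    rw [← Finset.card_union_of_disjoint Finset.disjoint_sdiff, Finset.union_sdiff_self_eq_union]
  rw [deficiency, deficiency, vars_union, Finset.card_union_of_disjoint hd, h2] at h1
  push_cast at h1
  omega

/-- Comparison with the empty sub-formula, whose deficiency is 0. -/
theorem IsMU.one_le_deficiency {Φ : CNF} (h : IsMU Φ) : 1 ≤ deficiency Φ := by
  have hne : Φ ≠ ∅ := by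
    rintro rfl
    exact h.1 ⟨fun _ => true, fun C hC => absurd hC (Finset.notMem_empty C)⟩
  have := h.deficiency_lt (Finset.empty_ssubset.2 (Finset.nonempty_iff_ne_empty.2 hne))
  simp only [deficiency, vars, Finset.card_empty, Finset.biUnion_empty] at this ⊢
  omega

theorem IsMUOfDeficiency.card_eq {Φ : CNF} (h : IsMUOfDeficiency 1 Φ) :
    Φ.card = (vars Φ).card + 1 := by
  have := h.2
  simp only [deficiency] at this
  omega

theorem IsMUOfDeficiency.card_le_of_ssubset {Φ Ψ : CNF} (h : IsMUOfDeficiency 1 Φ) (hs : Ψ ⊂ Φ) :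
    Ψ.card ≤ (vars Ψ).card := by
  have h1 := h.1.deficiency_lt hs
  rw [h.2, deficiency] at h1
  omega

/-! ### Splitting a formula of deficiency one -/

theorem vars_image_erase {Φ : CNF} {x : ℕ} {b : Bool} (h : ∀ C ∈ Φ, (x, !b) ∉ C) :
    vars (Φ.image fun C => C.erase (x, b)) = (vars Φ).erase x := by
  ext y
  simp only [mem_vars, Finset.mem_image, Finset.mem_erase]
  constructor
  · rintro ⟨_, ⟨C, hC, rfl⟩, c, hc⟩
    obtain ⟨hc1, hc2⟩ := Finset.mem_erase.1 hc
    refine ⟨?_, C, hC, c, hc2⟩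
    rintro rfl
    have : c = !b := by cases b <;> cases c <;> simp_all
    exact h C hC (this ▸ hc2)
  · rintro ⟨hyx, C, hC, c, hc⟩
    exact ⟨_, ⟨C, hC, rfl⟩, c, Finset.mem_erase.2 ⟨by simp [hyx], hc⟩⟩

/-- The clauses `Ψ` of `Φ` yield a minimal unsatisfiable formula when `(x, b)` is made false. -/
structure IsHalf (Φ : CNF) (x : ℕ) (b : Bool) (Ψ : CNF) : Prop where
  subset : Ψ ⊆ Φ
  not_mem : ∀ C ∈ Ψ, (x, !b) ∉ C
  injOn : Set.InjOn (fun C : Clause => C.erase (x, b)) Ψ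
  isMU : IsMU (Ψ.image fun C => C.erase (x, b))

theorem exists_isHalf {Φ : CNF} (h : ¬ Satisfiable Φ) (x : ℕ) (b : Bool) :
    ∃ Ψ, IsHalf Φ x b Ψ := by
  have hU : ¬ Satisfiable ((Φ.filter fun C => (x, !b) ∉ C).image fun C => C.erase (x, b)) := by
    rintro ⟨ν, hν⟩
    refine h ⟨Function.update ν x (!b), fun C hC => ?_⟩
    by_cases hCx : (x, !b) ∈ C
    · exact ⟨_, hCx, by simp⟩
    · obtain ⟨l, hl, hv⟩ := hν _ (Finset.mem_image.2 ⟨C, Finset.mem_filter.2 ⟨hC, hCx⟩, rfl⟩)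
      obtain ⟨hl1, hl2⟩ := Finset.mem_erase.1 hl
      refine ⟨l, hl2, ?_⟩
      have : l.1 ≠ x := by
        rintro rfl
        by_cases hlb : l.2 = b
        · exact hl1 (by rw [← hlb])
        · have : l.2 = !b := by cases b <;> cases h : l.2 <;> simp_all
          exact hCx (this ▸ hl2)
      rw [Function.update_of_ne this, hv]
  -- Minimality is imposed on the original clauses, not on their images. This also gives
  -- injectivity: of two clauses with the same image one could be dropped.
  obtain ⟨Ψ, hΨ, h1, h2⟩ := exists_minimal_subset
    (P := fun Ψ : CNF => ¬ Satisfiable (Ψ.image fun C => C.erase (x, b))) hU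
  refine ⟨Ψ, hΨ.trans (Finset.filter_subset _ _), fun C hC => (Finset.mem_filter.1 (hΨ hC)).2,
    ?_, h1, ?_⟩
  · intro C hC D hD he
    by_contra hne
    refine h2 (Ψ.erase C) (Finset.erase_ssubset hC) ?_
    convert h1 using 2
    refine (Finset.image_subset_image (Finset.erase_subset _ _)).antisymm ?_
    intro E hE
    obtain ⟨E', hE', rfl⟩ := Finset.mem_image.1 hE
    by_cases hEC : E' = C
    · subst hEC
      exact Finset.mem_image.2 ⟨D, Finset.mem_erase.2 ⟨Ne.symm hne, hD⟩, he.symm⟩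
    · exact Finset.mem_image.2 ⟨E', Finset.mem_erase.2 ⟨hEC, hE'⟩, rfl⟩
  · intro X hX
    by_contra hXs
    have hXi : (Ψ.filter fun C => C.erase (x, b) ∈ X).image (fun C => C.erase (x, b)) = X := by
      ext E
      simp only [Finset.mem_image, Finset.mem_filter]
      constructor
      · rintro ⟨C, ⟨_, hC⟩, rfl⟩
        exact hC
      · intro hE
        obtain ⟨C, hC, rfl⟩ := Finset.mem_image.1 (hX.1 hE)
        exact ⟨C, ⟨hC, hE⟩, rfl⟩
    refine h2 (Ψ.filter fun C => C.erase (x, b) ∈ X) ?_ (by rwa [hXi])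
    refine (Finset.filter_subset _ _).ssubset_of_ne fun he => ?_
    rw [he] at hXi
    exact hX.ne hXi.symm

theorem IsHalf.vars_image {Φ Ψ : CNF} {x : ℕ} {b : Bool} (h : IsHalf Φ x b Ψ) :
    vars (Ψ.image fun C => C.erase (x, b)) = (vars Ψ).erase x :=
  vars_image_erase h.not_mem

theorem IsHalf.card_image {Φ Ψ : CNF} {x : ℕ} {b : Bool} (h : IsHalf Φ x b Ψ) :
    (Ψ.image fun C => C.erase (x, b)).card = Ψ.card :=
  Finset.card_image_of_injOn h.injOn

/-- An assignment `ν` that satisfies the union falsifies the literal `(x, !ν x)`, so it would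
satisfy the half in which this literal is erased. Hence the union is unsatisfiable, and minimality
of `Φ` applies. -/
theorem IsHalf.union_eq {Φ : CNF} (h : IsMU Φ) {x : ℕ} {P : Bool → CNF}
    (hP : ∀ b, IsHalf Φ x b (P b)) : P true ∪ P false = Φ := by
  refine h.eq_of_subset (Finset.union_subset (hP true).subset (hP false).subset) ?_
  rintro ⟨ν, hν⟩
  have hsub : ∀ b, P b ⊆ P true ∪ P false := by
    intro b
    cases b
    · exact Finset.subset_union_right
    · exact Finset.subset_union_left
  refine (hP (!ν x)).isMU.1 ⟨ν, fun E hE => ?_⟩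
  obtain ⟨C, hC, rfl⟩ := Finset.mem_image.1 hE
  obtain ⟨l, hl, hv⟩ := hν C (hsub _ hC)
  refine ⟨l, Finset.mem_erase.2 ⟨?_, hl⟩, hv⟩
  rintro rfl
  simp at hv

theorem IsHalf.mem_of_mem {Φ : CNF} (h : IsMU Φ) {x : ℕ} {P : Bool → CNF}
    (hP : ∀ b, IsHalf Φ x b (P b)) {C : Clause} (hC : C ∈ Φ) {b : Bool} (hb : (x, b) ∈ C) :
    C ∈ P b := by
  have hC' := hC
  rw [← IsHalf.union_eq h hP, Finset.mem_union] at hC'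
  have : C ∈ P b ∨ C ∈ P (!b) := by
    cases b
    · exact hC'.symm
    · exact hC'
  refine this.resolve_right fun hn => (hP (!b)).not_mem C hn ?_
  simpa using hb

theorem IsHalf.mem_vars {Φ : CNF} (h : IsMU Φ) {x : ℕ} (hx : x ∈ vars Φ) {P : Bool → CNF}
    (hP : ∀ b, IsHalf Φ x b (P b)) (b : Bool) : x ∈ vars (P b) := by
  obtain ⟨C, hC, hb⟩ := h.exists_mem hx b
  exact ReadOnce.mem_vars.2 ⟨C, mem_of_mem h hP hC hb, b, hb⟩

theorem IsHalf.not_mem_vars_inter {Φ : CNF} {x : ℕ} {P : Bool → CNF}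
    (hP : ∀ b, IsHalf Φ x b (P b)) : x ∉ vars (P true ∩ P false) := by
  intro hx
  obtain ⟨C, hC, b, hb⟩ := ReadOnce.mem_vars.1 hx
  obtain ⟨h1, h2⟩ := Finset.mem_inter.1 hC
  cases b
  · exact (hP true).not_mem C h1 hb
  · exact (hP false).not_mem C h2 hb

/-- Three inequalities hold: each half has at least as many clauses as variables, the common clauses
are at most as many as their variables, and the shared variables include `x` and those of the common
clauses. Inclusion–exclusion for clauses and for variables, with `Φ.card = (vars Φ).card + 1`,
closes the chain and forces equality throughout. -/
theorem IsHalf.tight {Φ : CNF} (h : IsMUOfDeficiency 1 Φ) {x : ℕ} (hx : x ∈ vars Φ)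
    {P : Bool → CNF} (hP : ∀ b, IsHalf Φ x b (P b)) :
    (P true ∩ P false).card = (vars (P true ∩ P false)).card ∧
    vars (P true) ∩ vars (P false) = insert x (vars (P true ∩ P false)) ∧
    ∀ b, IsMUOfDeficiency 1 ((P b).image fun C => C.erase (x, b)) := by
  have hun := IsHalf.union_eq h.1 hP
  have hle : ∀ b, (vars (P b)).card ≤ (P b).card := by
    intro b
    have h1 := (hP b).isMU.one_le_deficiency
    rw [deficiency, (hP b).card_image, (hP b).vars_image,
      Finset.card_erase_of_mem (IsHalf.mem_vars h.1 hx hP b)] at h1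
    have : 0 < (vars (P b)).card := Finset.card_pos.2 ⟨x, IsHalf.mem_vars h.1 hx hP b⟩
    omega
  have hK : P true ∩ P false ⊂ Φ := by
    refine (Finset.inter_subset_left.trans (hP true).subset).ssubset_of_ne fun he => ?_
    exact IsHalf.not_mem_vars_inter hP (he.symm ▸ hx)
  have hKle := h.card_le_of_ssubset hK
  have hsub : insert x (vars (P true ∩ P false)) ⊆ vars (P true) ∩ vars (P false) := by
    refine Finset.insert_subset (Finset.mem_inter.2
      ⟨IsHalf.mem_vars h.1 hx hP _, IsHalf.mem_vars h.1 hx hP _⟩) ?_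
    exact Finset.subset_inter (vars_mono Finset.inter_subset_left)
      (vars_mono Finset.inter_subset_right)
  have hins := Finset.card_insert_of_notMem (IsHalf.not_mem_vars_inter hP)
  have hc1 := Finset.card_union_add_card_inter (P true) (P false)
  have hc2 := Finset.card_union_add_card_inter (vars (P true)) (vars (P false))
  rw [← vars_union, hun] at hc2
  rw [hun] at hc1
  have hcard := h.card_eq
  have ht := hle true
  have hf := hle false
  have hsc := Finset.card_le_card hsub
  refine ⟨by omega, (Finset.eq_of_subset_of_card_le hsub (by omega)).symm, fun b => ⟨(hP b).isMU, ?_⟩⟩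
  have hb : (P b).card = (vars (P b)).card := by cases b <;> omega
  rw [deficiency, (hP b).card_image, (hP b).vars_image,
      Finset.card_erase_of_mem (IsHalf.mem_vars h.1 hx hP b)]
  have : 0 < (vars (P b)).card := Finset.card_pos.2 ⟨x, IsHalf.mem_vars h.1 hx hP b⟩
  omega

/-! ### Variables that occur once in each sign -/

def OccursOnce (Φ : CNF) (y : ℕ) : Prop :=
  ∀ b, (Φ.filter fun C => (y, b) ∈ C).card = 1

/-- Transfers the count from a half back to `Φ`: erasing `(x, b)` is injective on the half and does
not touch `y`, which occurs nowhere else. -/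
theorem OccursOnce.of_isHalf {Φ : CNF} {x y : ℕ} {b : Bool} {Ψ : CNF} (hΨ : IsHalf Φ x b Ψ)
    (hyx : y ≠ x) (hy : ∀ C ∈ Φ, C ∉ Ψ → ∀ c, (y, c) ∉ C)
    (h : OccursOnce (Ψ.image fun C => C.erase (x, b)) y) : OccursOnce Φ y := by
  intro c
  rw [← h c]
  have h1 : ((Ψ.image fun C => C.erase (x, b)).filter fun C => (y, c) ∈ C) =
      (Φ.filter fun C => (y, c) ∈ C).image fun C => C.erase (x, b) := by
    ext E
    simp only [Finset.mem_filter, Finset.mem_image]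
    constructor
    · rintro ⟨⟨C, hC, rfl⟩, hE⟩
      exact ⟨C, ⟨hΨ.subset hC, (Finset.mem_erase.1 hE).2⟩, rfl⟩
    · rintro ⟨C, ⟨hC, hc⟩, rfl⟩
      refine ⟨⟨C, ?_, rfl⟩, Finset.mem_erase.2 ⟨by simp [hyx], hc⟩⟩
      by_contra hCΨ
      exact hy C hC hCΨ c hc
  rw [h1, Finset.card_image_of_injOn]
  refine hΨ.injOn.mono fun C hC => ?_
  obtain ⟨hC1, hC2⟩ := Finset.mem_filter.1 hC
  by_contra hCΨ
  exact hy C hC1 hCΨ c hC2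

/-- Outside every tight set of clauses there is a variable that occurs once in each sign. -/
theorem exists_occursOnce_of_tight {Φ : CNF} (h : IsMUOfDeficiency 1 Φ) {K : CNF} (hK : K ⊆ Φ)
    (hKt : K.card = (vars K).card) (hKv : vars K ≠ vars Φ) :
    ∃ y ∈ vars Φ, y ∉ vars K ∧ OccursOnce Φ y := by
  induction hn : (vars Φ).card using Nat.strong_induction_on generalizing Φ K with
  | _ n ih =>
  subst hn
  obtain ⟨x, hx, hxK⟩ : ∃ x ∈ vars Φ, x ∉ vars K := by
    by_contra hne
    push Not at hne
    exact hKv ((vars_mono hK).antisymm hne)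
  choose P hP using exists_isHalf h.1.1 x
  obtain ⟨hIt, hW, hF⟩ := IsHalf.tight h hx hP
  have hun := IsHalf.union_eq h.1 hP
  set I := P true ∩ P false with hI
  have hxI : x ∉ vars I := IsHalf.not_mem_vars_inter hP
  have hIΦ : I ⊆ Φ := Finset.inter_subset_left.trans (hP true).subset
  have ssub : ∀ X ⊆ Φ, x ∉ vars X → X.card ≤ (vars X).card := fun X hX hxX =>
    h.card_le_of_ssubset (hX.ssubset_of_ne fun he => hxX (he.symm ▸ hx))
  set Q := K ∪ I with hQ
  have hQΦ : Q ⊆ Φ := Finset.union_subset hK hIΦ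
  have hxQ : x ∉ vars Q := by
    rw [hQ, vars_union, Finset.mem_union]
    tauto
  -- Uncrossing: the number of variables is submodular and the number of clauses modular, and no
  -- sub-formula without `x` has more clauses than variables, so a union of tight sets that avoids
  -- `x` is tight.
  have hQt : Q.card = (vars Q).card := by
    have h1 := ssub Q hQΦ hxQ
    have h2 := ssub (K ∩ I) (Finset.inter_subset_left.trans hK)
      fun hx' => hxK (vars_mono Finset.inter_subset_left hx')
    have h3 := Finset.card_le_card (Finset.subset_inter
      (vars_mono (Finset.inter_subset_left (s₁ := K) (s₂ := I)))
      (vars_mono (Finset.inter_subset_right (s₁ := K) (s₂ := I))))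
    have h4 := Finset.card_union_add_card_inter K I
    have h5 := Finset.card_union_add_card_inter (vars K) (vars I)
    rw [← vars_union, ← hQ] at h5
    rw [← hQ] at h4
    omega
  have hQu : (Q ∩ P true) ∪ (Q ∩ P false) = Q := by
    rw [← Finset.inter_union_distrib_left, hun, Finset.inter_eq_left]
    exact hQΦ
  have hQi : (Q ∩ P true) ∩ (Q ∩ P false) = I := by
    rw [← Finset.inter_inter_distrib_left, ← hI, Finset.inter_eq_right]
    exact Finset.subset_union_right
  have hQv : vars (Q ∩ P true) ∩ vars (Q ∩ P false) ⊆ vars I := by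
    intro y hy
    obtain ⟨h1, h2⟩ := Finset.mem_inter.1 hy
    have h3 : y ∈ vars (P true) ∩ vars (P false) := Finset.mem_inter.2
      ⟨vars_mono Finset.inter_subset_right h1, vars_mono Finset.inter_subset_right h2⟩
    rw [hW, Finset.mem_insert] at h3
    refine h3.resolve_left ?_
    rintro rfl
    exact hxQ (vars_mono Finset.inter_subset_left h1)
  have hxQb : ∀ b, x ∉ vars (Q ∩ P b) := fun b hx' => hxQ (vars_mono Finset.inter_subset_left hx')
  -- The same counting in reverse: `Q` and `I` are tight and are the union and the intersection of
  -- the two parts of `Q`, so both parts are tight.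
  have hQbt : ∀ b, (Q ∩ P b).card = (vars (Q ∩ P b)).card := by
    have h1 : ∀ b, (Q ∩ P b).card ≤ (vars (Q ∩ P b)).card := fun b =>
      ssub _ (Finset.inter_subset_left.trans hQΦ) (hxQb b)
    have h2 := Finset.card_union_add_card_inter (Q ∩ P true) (Q ∩ P false)
    have h3 := Finset.card_union_add_card_inter (vars (Q ∩ P true)) (vars (Q ∩ P false))
    rw [← vars_union, hQu] at h3
    rw [hQu, hQi] at h2
    have h4 := Finset.card_le_card hQv
    have ht := h1 true
    have hf := h1 false
    intro b
    cases b <;> omega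
  have hPv : ∀ b, vars (P b) ⊆ vars Φ := fun b => vars_mono (hP b).subset
  -- If the part of `Q` in some half leaves a variable other than `x` uncovered, induction applies
  -- in that half. The variable found lies outside `vars I`, hence not in the other half.
  by_cases hcase : ∃ b, vars (Q ∩ P b) ≠ (vars (P b)).erase x
  · obtain ⟨b, hb⟩ := hcase
    have hsub : Q ∩ P b ⊆ (P b).image fun C => C.erase (x, b) := by
      intro C hC
      refine Finset.mem_image.2 ⟨C, (Finset.mem_inter.1 hC).2, Finset.erase_eq_of_notMem ?_⟩
      exact fun hxC => hxQb b (mem_vars.2 ⟨C, hC, b, hxC⟩)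
    obtain ⟨y, hy, hyQ, hyo⟩ := ih _ (by
      rw [(hP b).vars_image]
      exact Finset.card_lt_card ((Finset.erase_subset_erase x (hPv b)).trans_ssubset
        (Finset.erase_ssubset hx))) (hF b) hsub (hQbt b) (by rwa [(hP b).vars_image]) rfl
    rw [(hP b).vars_image, Finset.mem_erase] at hy
    have hyI : y ∉ vars I := fun hyI => hyQ (vars_mono (by
      rw [← hQi]
      cases b
      · exact Finset.inter_subset_right
      · exact Finset.inter_subset_left) hyI)
    have hyP : y ∉ vars (P (!b)) := by
      intro hyP
      have h3 : y ∈ vars (P true) ∩ vars (P false) := by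
        cases b
        · exact Finset.mem_inter.2 ⟨hyP, hy.2⟩
        · exact Finset.mem_inter.2 ⟨hy.2, hyP⟩
      rw [hW, Finset.mem_insert] at h3
      exact h3.elim hy.1 hyI
    have hor : ∀ C ∈ Φ, C ∈ P b ∨ C ∈ P (!b) := by
      intro C hC
      rw [← hun, Finset.mem_union] at hC
      cases b
      · exact hC.symm
      · exact hC
    refine ⟨y, hPv b hy.2, fun hyK => ?_, OccursOnce.of_isHalf (hP b) hy.1 (fun C hC hCP c hc => ?_)
      hyo⟩
    · obtain ⟨C, hC, c, hc⟩ := mem_vars.1 hyK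
      rcases hor C (hK hC) with hCb | hCb
      · exact hyQ (mem_vars.2
          ⟨C, Finset.mem_inter.2 ⟨Finset.mem_union_left _ hC, hCb⟩, c, hc⟩)
      · exact hyP (mem_vars.2 ⟨C, hCb, c, hc⟩)
    · exact hyP (mem_vars.2 ⟨C, (hor C hC).resolve_left hCP, c, hc⟩)
  -- Otherwise `Q ∩ P b` has as many clauses as `P b` has variables other than `x`, which is one
  -- less than the number of clauses of `P b`. Exactly one clause of each half is thus outside `Q`,
  -- and only it can contain `x`.
  · push Not at hcase
    refine ⟨x, hx, hxK, fun b => le_antisymm ?_ ?_⟩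
    · have hsub : (Φ.filter fun C => (x, b) ∈ C) ⊆ P b \ (Q ∩ P b) := by
        intro C hC
        obtain ⟨hC1, hC2⟩ := Finset.mem_filter.1 hC
        exact Finset.mem_sdiff.2 ⟨IsHalf.mem_of_mem h.1 hP hC1 hC2,
          fun hCQ => hxQb b (mem_vars.2 ⟨C, hCQ, b, hC2⟩)⟩
      refine (Finset.card_le_card hsub).trans ?_
      rw [Finset.card_sdiff_of_subset Finset.inter_subset_right, hQbt b, hcase b]
      have h1 := (hF b).card_eq
      rw [(hP b).card_image, (hP b).vars_image] at h1
      omega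
    · obtain ⟨C, hC, hb⟩ := h.1.exists_mem hx b
      exact Finset.card_pos.2 ⟨C, Finset.mem_filter.2 ⟨hC, hb⟩⟩

theorem exists_occursOnce {Φ : CNF} (h : IsMUOfDeficiency 1 Φ) (hv : (vars Φ).Nonempty) :
    ∃ y ∈ vars Φ, OccursOnce Φ y := by
  obtain ⟨y, hy, _, ho⟩ := exists_occursOnce_of_tight h (Finset.empty_subset Φ) (by simp [vars])
    (by simpa [vars] using hv.ne_empty.symm)
  exact ⟨y, hy, ho⟩

/-! ### Elimination of a variable that occurs once in each sign -/

/-- The clauses `C` and `D` are the only ones with the literals `y` and `¬ y`. -/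
structure OnlyIn (Φ : CNF) (y : ℕ) (C D : Clause) : Prop where
  pos : (Φ.filter fun E => (y, true) ∈ E) = {C}
  neg : (Φ.filter fun E => (y, false) ∈ E) = {D}

theorem OccursOnce.exists_onlyIn {Φ : CNF} {y : ℕ} (h : OccursOnce Φ y) :
    ∃ C D, OnlyIn Φ y C D := by
  obtain ⟨C, hC⟩ := Finset.card_eq_one.1 (h true)
  obtain ⟨D, hD⟩ := Finset.card_eq_one.1 (h false)
  exact ⟨C, D, hC, hD⟩

def ResStep.others (s : ResStep) (Φ : CNF) : CNF :=
  Φ.filter fun E => (s.pivot, true) ∉ E ∧ (s.pivot, false) ∉ E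

/-- The formula with the parents of `s` replaced by the resolvent. -/
def ResStep.eliminate (s : ResStep) (Φ : CNF) : CNF :=
  insert s.resolvent (s.others Φ)

section Elimination

variable {Φ : CNF} {s : ResStep}

theorem OnlyIn.left_mem (ho : OnlyIn Φ s.pivot s.left s.right) :
    s.left ∈ Φ ∧ (s.pivot, true) ∈ s.left := by
  have : s.left ∈ Φ.filter fun E => (s.pivot, true) ∈ E := ho.pos ▸ Finset.mem_singleton_self _
  simpa using this

theorem OnlyIn.right_mem (ho : OnlyIn Φ s.pivot s.left s.right) :
    s.right ∈ Φ ∧ (s.pivot, false) ∈ s.right := by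
  have : s.right ∈ Φ.filter fun E => (s.pivot, false) ∈ E := ho.neg ▸ Finset.mem_singleton_self _
  simpa using this

theorem OnlyIn.valid (ho : OnlyIn Φ s.pivot s.left s.right) : s.Valid Φ :=
  ⟨ho.left_mem.1, ho.right_mem.1, ho.left_mem.2, ho.right_mem.2⟩

theorem OnlyIn.cases (ho : OnlyIn Φ s.pivot s.left s.right) {E : Clause} (hE : E ∈ Φ) :
    E = s.left ∨ E = s.right ∨ E ∈ s.others Φ := by
  by_cases ht : (s.pivot, true) ∈ E
  · exact .inl (Finset.mem_singleton.1 (ho.pos ▸ Finset.mem_filter.2 ⟨hE, ht⟩))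
  by_cases hf : (s.pivot, false) ∈ E
  · exact .inr (.inl (Finset.mem_singleton.1 (ho.neg ▸ Finset.mem_filter.2 ⟨hE, hf⟩)))
  exact .inr (.inr (Finset.mem_filter.2 ⟨hE, ht, hf⟩))

theorem ResStep.others_subset : s.others Φ ⊆ Φ :=
  Finset.filter_subset _ _

theorem ResStep.resolvent_sound {ν : ℕ → Bool} (hl : ∃ l ∈ s.left, ν l.1 = l.2)
    (hr : ∃ l ∈ s.right, ν l.1 = l.2) : ∃ l ∈ s.resolvent, ν l.1 = l.2 := by
  obtain ⟨l, hl1, hl2⟩ := hl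
  obtain ⟨r, hr1, hr2⟩ := hr
  by_cases hlp : l = (s.pivot, true)
  · refine ⟨r, Finset.mem_union_right _ (Finset.mem_erase.2 ⟨?_, hr1⟩), hr2⟩
    rintro rfl
    subst hlp
    simp_all
  · exact ⟨l, Finset.mem_union_left _ (Finset.mem_erase.2 ⟨hlp, hl1⟩), hl2⟩

theorem OnlyIn.not_satisfiable (ho : OnlyIn Φ s.pivot s.left s.right) (h : IsMU Φ) :
    ¬ Satisfiable (s.eliminate Φ) := by
  rintro ⟨ν, hν⟩
  have hloc : ∀ b (l : Literal), l.1 ≠ s.pivot → ν l.1 = l.2 →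
      Function.update ν s.pivot b l.1 = l.2 := fun b l hl hv => by
    rw [Function.update_of_ne hl, hv]
  have hoth : ∀ b, ∀ E ∈ s.others Φ, ∃ l ∈ E, Function.update ν s.pivot b l.1 = l.2 := by
    intro b E hE
    obtain ⟨l, hl, hv⟩ := hν E (Finset.mem_insert_of_mem hE)
    refine ⟨l, hl, hloc b l ?_ hv⟩
    intro hp
    obtain ⟨_, h1, h2⟩ := Finset.mem_filter.1 hE
    rcases l with ⟨y, c⟩
    cases c <;> simp_all
  obtain ⟨l, hl, hv⟩ := hν _ (Finset.mem_insert_self _ _)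
  -- The true literal of the resolvent satisfies the parent it comes from, and the pivot is set so
  -- as to satisfy the other parent.
  rcases Finset.mem_union.1 hl with hl | hl
  · obtain ⟨hl1, hl2⟩ := Finset.mem_erase.1 hl
    refine h.1 ⟨Function.update ν s.pivot false, fun E hE => ?_⟩
    rcases ho.cases hE with rfl | rfl | hE
    · refine ⟨l, hl2, hloc _ l ?_ hv⟩
      intro hp
      have := h.not_tautology hE ho.left_mem.2
      rcases l with ⟨y, c⟩
      cases c <;> simp_all
    · exact ⟨_, ho.right_mem.2, by simp⟩
    · exact hoth _ E hE
  · obtain ⟨hl1, hl2⟩ := Finset.mem_erase.1 hl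
    refine h.1 ⟨Function.update ν s.pivot true, fun E hE => ?_⟩
    rcases ho.cases hE with rfl | rfl | hE
    · exact ⟨_, ho.left_mem.2, by simp⟩
    · refine ⟨l, hl2, hloc _ l ?_ hv⟩
      intro hp
      have := fun ht => h.not_tautology hE ht ho.right_mem.2
      rcases l with ⟨y, c⟩
      cases c <;> simp_all
    · exact hoth _ E hE

/-- Otherwise the eliminated formula would be a proper sub-formula of `Φ`, hence satisfiable. So
elimination lowers the number of clauses by exactly one, and a list without repeated clauses stays
one. -/
theorem OnlyIn.resolvent_notMem (ho : OnlyIn Φ s.pivot s.left s.right) (h : IsMU Φ) :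
    s.resolvent ∉ s.others Φ := by
  intro hm
  apply ho.not_satisfiable h
  rw [ResStep.eliminate, Finset.insert_eq_of_mem hm]
  refine h.2 _ (s.others_subset.ssubset_of_ne fun he => ?_)
  have := ho.left_mem.1
  rw [← he] at this
  exact (Finset.mem_filter.1 this).2.1 ho.left_mem.2

/-- Without the resolvent, what remains lies in `Φ` minus a parent. Without another clause `E`, an
assignment for `Φ.erase E` satisfies both parents and so the resolvent. -/
theorem OnlyIn.isMU (ho : OnlyIn Φ s.pivot s.left s.right) (h : IsMU Φ) :
    IsMU (s.eliminate Φ) := by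
  refine ⟨ho.not_satisfiable h, fun X hX => ?_⟩
  obtain ⟨E, hE, hEX⟩ := Finset.exists_of_ssubset hX
  have hsub : X ⊆ (s.eliminate Φ).erase E := fun D hD =>
    Finset.mem_erase.2 ⟨fun e => hEX (e ▸ hD), hX.1 hD⟩
  suffices hs : Satisfiable ((s.eliminate Φ).erase E) from hs.imp fun ν hν => hν.mono hsub
  rcases Finset.mem_insert.1 hE with rfl | hE
  · obtain ⟨ν, hν⟩ := h.satisfiable_erase ho.left_mem.1
    refine ⟨ν, hν.mono fun D hD => ?_⟩
    obtain ⟨h1, h2⟩ := Finset.mem_erase.1 hD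
    have h3 := (Finset.mem_insert.1 h2).resolve_left h1
    refine Finset.mem_erase.2 ⟨?_, s.others_subset h3⟩
    rintro rfl
    exact (Finset.mem_filter.1 h3).2.1 ho.left_mem.2
  · obtain ⟨ν, hν⟩ := h.satisfiable_erase (s.others_subset hE)
    refine ⟨ν, fun D hD => ?_⟩
    obtain ⟨h1, h2⟩ := Finset.mem_erase.1 hD
    rcases Finset.mem_insert.1 h2 with rfl | h3
    · refine ResStep.resolvent_sound (hν _ (Finset.mem_erase.2 ⟨?_, ho.left_mem.1⟩))
        (hν _ (Finset.mem_erase.2 ⟨?_, ho.right_mem.1⟩))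
      · rintro rfl
        exact (Finset.mem_filter.1 hE).2.1 ho.left_mem.2
      · rintro rfl
        exact (Finset.mem_filter.1 hE).2.2 ho.right_mem.2
    · exact hν D (Finset.mem_erase.2 ⟨h1, s.others_subset h3⟩)

theorem OnlyIn.not_mem_resolvent (ho : OnlyIn Φ s.pivot s.left s.right) (h : IsMU Φ) (b : Bool) :
    (s.pivot, b) ∉ s.resolvent := by
  have h1 := h.not_tautology ho.left_mem.1 ho.left_mem.2
  have h2 := fun ht => h.not_tautology ho.right_mem.1 ht ho.right_mem.2
  cases b <;> simp_all [ResStep.resolvent]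

theorem OnlyIn.vars_eliminate (ho : OnlyIn Φ s.pivot s.left s.right) (h : IsMU Φ) :
    vars (s.eliminate Φ) = (vars Φ).erase s.pivot := by
  ext x
  rw [mem_vars, Finset.mem_erase, mem_vars]
  constructor
  · rintro ⟨E, hE, b, hb⟩
    rcases Finset.mem_insert.1 hE with rfl | hE
    · refine ⟨?_, ?_⟩
      · rintro rfl
        exact ho.not_mem_resolvent h b hb
      · rcases Finset.mem_union.1 hb with hb | hb
        · exact ⟨_, ho.left_mem.1, b, Finset.mem_of_mem_erase hb⟩
        · exact ⟨_, ho.right_mem.1, b, Finset.mem_of_mem_erase hb⟩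
    · refine ⟨?_, E, s.others_subset hE, b, hb⟩
      rintro rfl
      obtain ⟨_, h1, h2⟩ := Finset.mem_filter.1 hE
      cases b <;> simp_all
  · rintro ⟨hxs, E, hE, b, hb⟩
    rcases ho.cases hE with rfl | rfl | hE
    · exact ⟨_, Finset.mem_insert_self _ _, b,
        Finset.mem_union_left _ (Finset.mem_erase.2 ⟨by simp [hxs], hb⟩)⟩
    · exact ⟨_, Finset.mem_insert_self _ _, b,
        Finset.mem_union_right _ (Finset.mem_erase.2 ⟨by simp [hxs], hb⟩)⟩
    · exact ⟨E, Finset.mem_insert_of_mem hE, b, hb⟩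

theorem OnlyIn.left_ne_right (ho : OnlyIn Φ s.pivot s.left s.right) (h : IsMU Φ) :
    s.left ≠ s.right := fun e =>
  h.not_tautology ho.left_mem.1 ho.left_mem.2 (e ▸ ho.right_mem.2)

theorem OnlyIn.card_others (ho : OnlyIn Φ s.pivot s.left s.right) (h : IsMU Φ) :
    (s.others Φ).card + 2 = Φ.card := by
  have h1 : s.others Φ = (Φ.erase s.left).erase s.right := by
    ext E
    rw [Finset.mem_erase, Finset.mem_erase]
    constructor
    · intro hE
      obtain ⟨h1, h2, h3⟩ := Finset.mem_filter.1 hE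
      refine ⟨?_, ?_, h1⟩
      · rintro rfl
        exact h3 ho.right_mem.2
      · rintro rfl
        exact h2 ho.left_mem.2
    · rintro ⟨h1, h2, h3⟩
      exact ((ho.cases h3).resolve_left h2).resolve_left h1
  have h2 : s.right ∈ Φ.erase s.left :=
    Finset.mem_erase.2 ⟨(ho.left_ne_right h).symm, ho.right_mem.1⟩
  rw [h1, ← Finset.card_erase_add_one ho.left_mem.1, ← Finset.card_erase_add_one h2]

theorem OnlyIn.pivot_mem_vars (ho : OnlyIn Φ s.pivot s.left s.right) : s.pivot ∈ vars Φ :=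
  mem_vars.2 ⟨_, ho.left_mem.1, _, ho.left_mem.2⟩

theorem OnlyIn.isMUOfDeficiency (ho : OnlyIn Φ s.pivot s.left s.right)
    (h : IsMUOfDeficiency 1 Φ) : IsMUOfDeficiency 1 (s.eliminate Φ) := by
  refine ⟨ho.isMU h.1, ?_⟩
  have h1 := ho.card_others h.1
  have h2 := Finset.card_erase_add_one ho.pivot_mem_vars
  rw [deficiency, ho.vars_eliminate h.1, ResStep.eliminate,
    Finset.card_insert_of_notMem (ho.resolvent_notMem h.1)]
  have := h.card_eq
  omega

/-! ### Derivations and read-once refutations -/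

theorem Derives.mono {R : List ResStep} {Φ Ψ : CNF} {π : Clause} (h : Derives Φ R π) (hs : Φ ⊆ Ψ) :
    Derives Ψ R π := by
  induction R generalizing Φ Ψ with
  | nil => exact hs h
  | cons s R ih =>
    obtain ⟨⟨h1, h2, h3, h4⟩, h5⟩ := h
    exact ⟨⟨hs h1, hs h2, h3, h4⟩, ih h5 (Finset.insert_subset_insert _ hs)⟩

theorem Derives.pivot_mem_vars {R : List ResStep} {Φ : CNF} {π : Clause} (h : Derives Φ R π) :
    ∀ s ∈ R, s.pivot ∈ vars Φ := by
  induction R generalizing Φ with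
  | nil => simp
  | cons s R ih =>
    obtain ⟨⟨h1, h2, h3, h4⟩, h5⟩ := h
    have hv : vars (insert s.resolvent Φ) ⊆ vars Φ := by
      intro x hx
      obtain ⟨E, hE, b, hb⟩ := mem_vars.1 hx
      rcases Finset.mem_insert.1 hE with rfl | hE
      · rcases Finset.mem_union.1 hb with hb | hb
        · exact mem_vars.2 ⟨_, h1, b, Finset.mem_of_mem_erase hb⟩
        · exact mem_vars.2 ⟨_, h2, b, Finset.mem_of_mem_erase hb⟩
      · exact mem_vars.2 ⟨E, hE, b, hb⟩
    intro r hr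
    rcases List.mem_cons.1 hr with rfl | hr
    · exact mem_vars.2 ⟨_, h1, _, h3⟩
    · exact hv (ih h5 r hr)

/-- All pivots of `R` are variables of the eliminated formula, which no longer contains the pivot of
`s`. -/
theorem OnlyIn.isVarRORRefutation (ho : OnlyIn Φ s.pivot s.left s.right) (h : IsMU Φ)
    {R : List ResStep} (hR : IsVarRORRefutation (s.eliminate Φ) R) :
    IsVarRORRefutation Φ (s :: R) := by
  refine ⟨⟨ho.valid, hR.1.mono (Finset.insert_subset_insert _ s.others_subset)⟩, ?_⟩
  rw [List.map_cons, List.nodup_cons]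
  refine ⟨fun hm => ?_, hR.2⟩
  obtain ⟨r, hr, hrs⟩ := List.mem_map.1 hm
  have := hR.1.pivot_mem_vars r hr
  rw [ho.vars_eliminate h, hrs] at this
  exact Finset.notMem_erase _ _ this

end Elimination

theorem IsMU.eq_singleton_empty {Φ : CNF} (h : IsMU Φ) (hv : vars Φ = ∅) : Φ = {∅} := by
  have hE : ∀ C ∈ Φ, C = ∅ := by
    intro C hC
    refine Finset.eq_empty_of_forall_notMem fun l hl => ?_
    have : l.1 ∈ vars Φ := mem_vars.2 ⟨C, hC, l.2, hl⟩
    simp [hv] at this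
  refine Finset.eq_singleton_iff_unique_mem.2 ⟨?_, hE⟩
  by_contra hne
  refine h.1 ⟨fun _ => true, fun C hC => ?_⟩
  exact absurd (hE C hC ▸ hC) hne

theorem isVarRORRefutation_nil {Φ : CNF} (h : IsMU Φ) (hv : vars Φ = ∅) :
    IsVarRORRefutation Φ [] := by
  rw [h.eq_singleton_empty hv]
  exact ⟨Finset.mem_singleton_self _, List.nodup_nil⟩

/-- Induction over `MU(1)` by the elimination of variables that occur once in each sign. -/
theorem IsMUOfDeficiency.induction {motive : CNF → Prop}
    (empty : ∀ Φ, IsMUOfDeficiency 1 Φ → vars Φ = ∅ → motive Φ)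
    (step : ∀ Φ (s : ResStep), IsMUOfDeficiency 1 Φ → OnlyIn Φ s.pivot s.left s.right →
      motive (s.eliminate Φ) → motive Φ)
    {Φ : CNF} (h : IsMUOfDeficiency 1 Φ) : motive Φ := by
  induction hn : (vars Φ).card using Nat.strong_induction_on generalizing Φ with
  | _ n ih =>
  subst hn
  rcases (vars Φ).eq_empty_or_nonempty with hv | hv
  · exact empty Φ h hv
  obtain ⟨y, _, ho⟩ := exists_occursOnce h hv
  obtain ⟨C, D, ho⟩ := ho.exists_onlyIn
  have ho : OnlyIn Φ (ResStep.mk y C D).pivot (ResStep.mk y C D).left (ResStep.mk y C D).right := ho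
  refine step Φ _ h ho (ih _ ?_ (ho.isMUOfDeficiency h) rfl)
  rw [ho.vars_eliminate h.1]
  exact Finset.card_erase_lt_of_mem ho.pivot_mem_vars

theorem IsMUOfDeficiency.varROR {Φ : CNF} (h : IsMUOfDeficiency 1 Φ) : VarROR Φ := by
  refine IsMUOfDeficiency.induction (motive := VarROR) (fun Φ h hv => ?_)
    (fun Φ s h ho ih => ?_) h
  · exact ⟨[], isVarRORRefutation_nil h.1 hv⟩
  · obtain ⟨R, hR⟩ := ih
    exact ⟨_, ho.isVarRORRefutation h.1 hR⟩

/-! ### Variable-disjunctive splittings -/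

/-- Apart from `x` the variables fall into two classes, and each clause belongs to one of the
literals `x`, `¬ x` and has its other variables in the class of this literal. -/
structure Separation (Φ : CNF) (x : ℕ) (V : Bool → Finset ℕ) : Prop where
  mem_vars : x ∈ vars Φ
  not_mem : ∀ b, x ∉ V b
  subset : ∀ b, V b ⊆ vars Φ
  disjoint : ∀ b, Disjoint (V b) (V (!b))
  side : ∀ C ∈ Φ, ∃ b, ∀ l ∈ C, l = (x, b) ∨ l.1 ∈ V b

/-- A separation survives undoing an elimination: the resolvent lies on one side, the pivot joins
the class of that side, and both parents, made of literals of the resolvent and the pivot, lie there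
too. If no variable is left after the elimination, the pivot itself separates with empty classes. -/
theorem exists_separation {Φ : CNF} (h : IsMUOfDeficiency 1 Φ) (hv : (vars Φ).Nonempty) :
    ∃ x V, Separation Φ x V := by
  revert hv
  refine IsMUOfDeficiency.induction
    (motive := fun Φ => (vars Φ).Nonempty → ∃ x V, Separation Φ x V)
    (fun Φ h he hv => ?_) (fun Φ s h ho ih hv => ?_) h
  · exact absurd hv (by simp [he])
  · have hve := ho.vars_eliminate h.1
    rcases (vars (s.eliminate Φ)).eq_empty_or_nonempty with he | hne
    · refine ⟨s.pivot, fun _ => ∅, ho.pivot_mem_vars, by simp, by simp, by simp, fun C hC => ?_⟩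
      have hp : ∀ l ∈ C, l.1 = s.pivot := by
        intro l hl
        by_contra hne
        have : l.1 ∈ vars (s.eliminate Φ) :=
          hve ▸ Finset.mem_erase.2 ⟨hne, ReadOnce.mem_vars.2 ⟨C, hC, l.2, hl⟩⟩
        simp [he] at this
      by_cases ht : (s.pivot, true) ∈ C
      · refine ⟨true, fun l hl => .inl ?_⟩
        have := h.1.not_tautology hC ht
        rcases l with ⟨y, c⟩
        obtain rfl : y = s.pivot := hp _ hl
        cases c
        · exact absurd hl this
        · rfl
      · refine ⟨false, fun l hl => .inl ?_⟩
        rcases l with ⟨y, c⟩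
        obtain rfl : y = s.pivot := hp _ hl
        cases c
        · rfl
        · exact absurd hl ht
    · obtain ⟨x, V, hs⟩ := ih hne
      have hx := hs.mem_vars
      rw [hve, Finset.mem_erase] at hx
      have hV : ∀ b, s.pivot ∉ V b := fun b hb => by
        have := hs.subset b hb
        rw [hve] at this
        exact Finset.notMem_erase _ _ this
      obtain ⟨b, hb⟩ := hs.side _ (Finset.mem_insert_self _ _)
      refine ⟨x, Function.update V b (insert s.pivot (V b)), hx.2, fun c => ?_, fun c => ?_,
        fun c => ?_, fun C hC => ?_⟩
      · by_cases hcb : c = b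
        · subst hcb
          simpa [hx.1] using hs.not_mem c
        · rw [Function.update_of_ne hcb]
          exact hs.not_mem c
      · have hsub : V c ⊆ vars Φ := (hs.subset c).trans (hve ▸ Finset.erase_subset _ _)
        by_cases hcb : c = b
        · subst hcb
          rw [Function.update_self]
          exact Finset.insert_subset ho.pivot_mem_vars hsub
        · rwa [Function.update_of_ne hcb]
      · have hd := hs.disjoint c
        have := hV (!c)
        have := hV c
        cases b <;> cases c <;> simp_all
      · have hpar : (∀ l ∈ C, l.1 = s.pivot ∨ l ∈ s.resolvent) →
            ∃ c, ∀ l ∈ C, l = (x, c) ∨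
              l.1 ∈ Function.update V b (insert s.pivot (V b)) c := by
          intro hl
          refine ⟨b, fun l hlC => ?_⟩
          rw [Function.update_self]
          rcases hl l hlC with h1 | h1
          · exact .inr (h1 ▸ Finset.mem_insert_self _ _)
          · exact (hb l h1).imp_right (Finset.mem_insert_of_mem)
        rcases ho.cases hC with rfl | rfl | hC
        · refine hpar fun l hl => or_iff_not_imp_left.2 fun hlp => ?_
          exact Finset.mem_union_left _ (Finset.mem_erase.2 ⟨fun e => hlp (by rw [e]), hl⟩)
        · refine hpar fun l hl => or_iff_not_imp_left.2 fun hlp => ?_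
          exact Finset.mem_union_right _ (Finset.mem_erase.2 ⟨fun e => hlp (by rw [e]), hl⟩)
        · obtain ⟨c, hc⟩ := hs.side C (Finset.mem_insert_of_mem hC)
          refine ⟨c, fun l hl => (hc l hl).imp_right fun hm => ?_⟩
          by_cases hcb : c = b
          · subst hcb
            rw [Function.update_self]
            exact Finset.mem_insert_of_mem hm
          · rwa [Function.update_of_ne hcb]

/-- The choice of the sets `S` and `T` of clauses without `x` in a splitting. -/
structure IsDistribution (Φ : CNF) (x : ℕ) (V : Bool → Finset ℕ) (S : Bool → CNF) : Prop where
  side : ∀ b, ∀ C ∈ S b, ∀ l ∈ C, l.1 ∈ V b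
  disjoint : ∀ b, Disjoint (S b) (S (!b))
  union_eq : ∀ b, S b ∪ S (!b) = sigma Φ x

theorem Separation.exists_isDistribution {Φ : CNF} {x : ℕ} {V : Bool → Finset ℕ}
    (h : Separation Φ x V) : ∃ S, IsDistribution Φ x V S := by
  -- Only an empty clause would fit both sides; it goes to the side of `true`.
  let A := (sigma Φ x).filter fun C => ∀ l ∈ C, l.1 ∈ V true
  have hA : A ⊆ sigma Φ x := Finset.filter_subset _ _
  refine ⟨fun b => cond b A (sigma Φ x \ A), ?_, ?_, ?_⟩
  · intro b C hC l hl
    cases b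
    · obtain ⟨h1, h2⟩ := Finset.mem_sdiff.1 hC
      obtain ⟨h3, h4, h5⟩ := Finset.mem_filter.1 h1
      obtain ⟨b, hb⟩ := h.side C h3
      have hb' : ∀ l ∈ C, l.1 ∈ V b := fun l hl => (hb l hl).resolve_left (by
        rintro rfl
        cases b
        · exact h5 hl
        · exact h4 hl)
      cases b
      · exact hb' l hl
      · exact absurd (Finset.mem_filter.2 ⟨h1, hb'⟩) h2
    · exact (Finset.mem_filter.1 hC).2 l hl
  · intro b
    cases b
    · exact Finset.sdiff_disjoint
    · exact Finset.disjoint_sdiff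
  · intro b
    cases b
    · exact Finset.sdiff_union_of_subset hA
    · exact Finset.union_sdiff_of_subset hA

section Distribution

variable {Φ : CNF} {x : ℕ} {V : Bool → Finset ℕ} {S : Bool → CNF}

theorem IsDistribution.subset (hS : IsDistribution Φ x V S) (b : Bool) : S b ⊆ sigma Φ x :=
  hS.union_eq b ▸ Finset.subset_union_left

theorem IsDistribution.not_mem (hS : IsDistribution Φ x V S) {b : Bool} {C : Clause}
    (hC : C ∈ S b) (c : Bool) : (x, c) ∉ C := by
  obtain ⟨_, h1, h2⟩ := Finset.mem_filter.1 (hS.subset b hC)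
  cases c
  · exact h2
  · exact h1

/-- The clauses of `Φ` that go to the side of the literal `(x, b)`. -/
def sideClauses (Φ : CNF) (x : ℕ) (S : Bool → CNF) (b : Bool) : CNF :=
  (Φ.filter fun C => (x, b) ∈ C) ∪ S b

theorem IsDistribution.image_sideClauses (hS : IsDistribution Φ x V S) (b : Bool) :
    (sideClauses Φ x S b).image (fun C => C.erase (x, b)) = stripped Φ (x, b) ∪ S b := by
  rw [sideClauses, Finset.image_union, stripped]
  congr 1
  refine (Finset.image_congr fun C hC => ?_).trans Finset.image_id
  exact Finset.erase_eq_of_notMem (hS.not_mem hC b)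

theorem IsDistribution.sideClauses_subset (hS : IsDistribution Φ x V S) (b : Bool) :
    sideClauses Φ x S b ⊆ Φ :=
  Finset.union_subset (Finset.filter_subset _ _)
    ((hS.subset b).trans (Finset.filter_subset _ _))

theorem IsDistribution.mem_sideClauses (hS : IsDistribution Φ x V S) {C : Clause} (hC : C ∈ Φ)
    (b : Bool) : C ∈ sideClauses Φ x S b ∨ C ∈ sideClauses Φ x S (!b) := by
  by_cases h1 : (x, b) ∈ C
  · exact .inl (Finset.mem_union_left _ (Finset.mem_filter.2 ⟨hC, h1⟩))
  by_cases h2 : (x, !b) ∈ C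
  · exact .inr (Finset.mem_union_left _ (Finset.mem_filter.2 ⟨hC, h2⟩))
  have h3 : C ∈ sigma Φ x := by
    refine Finset.mem_filter.2 ⟨hC, ?_⟩
    cases b
    · exact ⟨h2, h1⟩
    · exact ⟨h1, h2⟩
  rw [← hS.union_eq b] at h3
  exact (Finset.mem_union.1 h3).imp (Finset.mem_union_right _) (Finset.mem_union_right _)

theorem IsDistribution.disjoint_sideClauses (hS : IsDistribution Φ x V S) (h : IsMU Φ) (b : Bool) :
    Disjoint (sideClauses Φ x S b) (sideClauses Φ x S (!b)) := by
  rw [Finset.disjoint_left]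
  intro C h1 h2
  rcases Finset.mem_union.1 h1 with h1 | h1
  · obtain ⟨hC, hb⟩ := Finset.mem_filter.1 h1
    rcases Finset.mem_union.1 h2 with h2 | h2
    · exact h.not_mem_of_mem hC hb (Finset.mem_filter.1 h2).2
    · exact hS.not_mem h2 _ hb
  · rcases Finset.mem_union.1 h2 with h2 | h2
    · exact hS.not_mem h1 _ (Finset.mem_filter.1 h2).2
    · exact Finset.disjoint_left.1 (hS.disjoint b) h1 h2

theorem IsDistribution.side_of_mem (hs : Separation Φ x V) (hS : IsDistribution Φ x V S) {b : Bool}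
    {C : Clause} (hC : C ∈ sideClauses Φ x S b) : ∀ l ∈ C, l = (x, b) ∨ l.1 ∈ V b := by
  rcases Finset.mem_union.1 hC with hC | hC
  · obtain ⟨hC, hb⟩ := Finset.mem_filter.1 hC
    obtain ⟨c, hc⟩ := hs.side C hC
    rcases hc _ hb with he | he
    · rw [show b = c from congrArg Prod.snd he]
      exact hc
    · exact absurd he (hs.not_mem c)
  · exact fun l hl => .inr (hS.side b C hC l hl)

/-- Glue two assignments: `ν` on the class of `b`, and elsewhere one that satisfies `Φ` without some
clause containing `(x, b)`. The latter takes care of every clause on the other side, so all of `Φ`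
would be satisfied. -/
theorem IsDistribution.not_satisfiable (hs : Separation Φ x V) (hS : IsDistribution Φ x V S)
    (h : IsMU Φ) (b : Bool) :
    ¬ Satisfiable ((sideClauses Φ x S b).image fun C => C.erase (x, b)) := by
  rintro ⟨ν, hν⟩
  obtain ⟨C₀, hC₀, hb₀⟩ := h.exists_mem hs.mem_vars b
  obtain ⟨μ, hμ⟩ := h.satisfiable_erase hC₀
  refine h.1 ⟨fun y => if y ∈ V b then ν y else μ y, fun C hC => ?_⟩
  rcases hS.mem_sideClauses hC b with hCb | hCb
  · obtain ⟨l, hl, hv⟩ := hν _ (Finset.mem_image_of_mem _ hCb)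
    obtain ⟨hl1, hl2⟩ := Finset.mem_erase.1 hl
    exact ⟨l, hl2, (if_pos ((hS.side_of_mem hs hCb l hl2).resolve_left hl1)).trans hv⟩
  · have hne : C ≠ C₀ := by
      rintro rfl
      exact Finset.disjoint_left.1 (hS.disjoint_sideClauses h b)
        (Finset.mem_union_left _ (Finset.mem_filter.2 ⟨hC, hb₀⟩)) hCb
    obtain ⟨l, hl, hv⟩ := hμ C (Finset.mem_erase.2 ⟨hne, hC⟩)
    refine ⟨l, hl, (if_neg ?_).trans hv⟩
    rcases hS.side_of_mem hs hCb l hl with rfl | hm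
    · exact hs.not_mem b
    · exact fun hm' => Finset.disjoint_left.1 (hs.disjoint b) hm' hm

theorem IsDistribution.isMU (hs : Separation Φ x V) (hS : IsDistribution Φ x V S)
    (h : IsMU Φ) (b : Bool) : IsMU ((sideClauses Φ x S b).image fun C => C.erase (x, b)) := by
  refine ⟨hS.not_satisfiable hs h b, fun X hX => ?_⟩
  obtain ⟨E, hE, hEX⟩ := Finset.exists_of_ssubset hX
  obtain ⟨C, hC, rfl⟩ := Finset.mem_image.1 hE
  obtain ⟨μ, hμ⟩ := h.satisfiable_erase (hS.sideClauses_subset b hC)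
  have key : ∀ c, ∀ D ∈ sideClauses Φ x S c, D ≠ C → μ x = (!c) →
      ∃ l ∈ D.erase (x, c), μ l.1 = l.2 := by
    intro c D hD hne hx
    obtain ⟨l, hl, hv⟩ := hμ D (Finset.mem_erase.2 ⟨hne, hS.sideClauses_subset c hD⟩)
    refine ⟨l, Finset.mem_erase.2 ⟨?_, hl⟩, hv⟩
    rintro rfl
    simp [hx] at hv
  -- If `μ` made `(x, b)` true, it would satisfy the other side, from which no clause was removed,
  -- without help from `x`.
  have hx : μ x = !b := by
    by_contra hx
    refine hS.not_satisfiable hs h (!b) ⟨μ, fun E hE => ?_⟩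
    obtain ⟨D, hD, rfl⟩ := Finset.mem_image.1 hE
    refine key (!b) D hD ?_ (by simpa using hx)
    rintro rfl
    exact Finset.disjoint_left.1 (hS.disjoint_sideClauses h b) hC hD
  refine ⟨μ, fun E hE' => ?_⟩
  obtain ⟨D, hD, rfl⟩ := Finset.mem_image.1 (hX.1 hE')
  refine key b D hD ?_ hx
  rintro rfl
  exact hEX hE'

theorem IsDistribution.vars_subset (hs : Separation Φ x V) (hS : IsDistribution Φ x V S) (b : Bool) :
    vars ((sideClauses Φ x S b).image fun C => C.erase (x, b)) ⊆ V b := by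
  intro y hy
  obtain ⟨E, hE, c, hc⟩ := mem_vars.1 hy
  obtain ⟨C, hC, rfl⟩ := Finset.mem_image.1 hE
  obtain ⟨h1, h2⟩ := Finset.mem_erase.1 hc
  exact (hS.side_of_mem hs hC _ h2).resolve_left h1

/-- The two sides together have at most `Φ.card` clauses and cover all variables but `x`, so their
deficiencies sum to at most 2; each is at least 1. -/
theorem IsDistribution.isMUOfDeficiency (hs : Separation Φ x V) (hS : IsDistribution Φ x V S)
    (h : IsMUOfDeficiency 1 Φ) (b : Bool) :
    IsMUOfDeficiency 1 ((sideClauses Φ x S b).image fun C => C.erase (x, b)) := by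
  refine ⟨hS.isMU hs h.1 b, ?_⟩
  have h1 := (hS.isMU hs h.1 b).one_le_deficiency
  have h2 := (hS.isMU hs h.1 (!b)).one_le_deficiency
  have hc : ∀ c, ((sideClauses Φ x S c).image fun C => C.erase (x, c)).card ≤
      (sideClauses Φ x S c).card := fun c => Finset.card_image_le
  have hcb := hc b
  have hcn := hc (!b)
  have h3 : (sideClauses Φ x S b).card + (sideClauses Φ x S (!b)).card ≤ Φ.card := by
    rw [← Finset.card_union_of_disjoint (hS.disjoint_sideClauses h.1 b)]
    exact Finset.card_le_card
      (Finset.union_subset (hS.sideClauses_subset b) (hS.sideClauses_subset (!b)))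
  have h4 : (vars Φ).erase x ⊆ vars ((sideClauses Φ x S b).image fun C => C.erase (x, b)) ∪
      vars ((sideClauses Φ x S (!b)).image fun C => C.erase (x, !b)) := by
    intro y hy
    obtain ⟨hyx, hy⟩ := Finset.mem_erase.1 hy
    obtain ⟨C, hC, c, hc⟩ := mem_vars.1 hy
    have key : ∀ d, C ∈ sideClauses Φ x S d →
        y ∈ vars ((sideClauses Φ x S d).image fun C => C.erase (x, d)) := fun d hd =>
      mem_vars.2 ⟨_, Finset.mem_image_of_mem _ hd, c, Finset.mem_erase.2 ⟨by simp [hyx], hc⟩⟩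
    exact Finset.mem_union.2 ((hS.mem_sideClauses hC b).imp (key b) (key (!b)))
  have h5 := (Finset.card_le_card h4).trans (Finset.card_union_le _ _)
  rw [Finset.card_erase_of_mem hs.mem_vars] at h5
  have h6 := h.card_eq
  have h7 : 0 < (vars Φ).card := Finset.card_pos.2 ⟨x, hs.mem_vars⟩
  rw [deficiency] at h1 h2 ⊢
  omega

end Distribution

theorem IsMUOfDeficiency.exists_splitting {Φ : CNF} (h : IsMUOfDeficiency 1 Φ)
    (hv : (vars Φ).Nonempty) : ∃ x F G, IsVarDisjunctiveSplitting Φ x F G ∧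
      IsMUOfDeficiency 1 F ∧ IsMUOfDeficiency 1 G ∧ vars F ⊂ vars Φ ∧ vars G ⊂ vars Φ := by
  obtain ⟨x, V, hs⟩ := exists_separation h hv
  obtain ⟨S, hS⟩ := hs.exists_isDistribution
  have hMU : ∀ b, IsMUOfDeficiency 1 (stripped Φ (x, b) ∪ S b) := fun b =>
    hS.image_sideClauses b ▸ hS.isMUOfDeficiency hs h b
  have hV : ∀ b, vars (stripped Φ (x, b) ∪ S b) ⊆ V b := fun b =>
    hS.image_sideClauses b ▸ hS.vars_subset hs b
  have hlt : ∀ b, vars (stripped Φ (x, b) ∪ S b) ⊂ vars Φ := fun b =>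
    ((hV b).trans (hs.subset b)).ssubset_of_ne fun he =>
      hs.not_mem b (hV b (he.symm ▸ hs.mem_vars))
  exact ⟨x, _, _, ⟨S true, S false, ⟨h.1, hs.mem_vars, hS.subset true, hS.subset false, rfl, rfl,
    (hMU true).1, (hMU false).1⟩, hS.disjoint true,
    Finset.disjoint_of_subset_left (hV true) (Finset.disjoint_of_subset_right (hV false)
      (hs.disjoint true))⟩, hMU true, hMU false, hlt true, hlt false⟩

theorem IsMUOfDeficiency.exists_tree {Φ : CNF} (h : IsMUOfDeficiency 1 Φ) :
    ∃ T, IsCompleteVarDisjunctiveTree Φ T := by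
  induction hn : (vars Φ).card using Nat.strong_induction_on generalizing Φ with
  | _ n ih =>
  subst hn
  by_cases hc : (vars Φ).card ≤ 1
  · exact ⟨.leaf Φ, rfl, h.1, hc⟩
  push Not at hc
  obtain ⟨x, F, G, hsp, hF, hG, hFv, hGv⟩ :=
    h.exists_splitting (Finset.card_pos.1 (Nat.zero_lt_one.trans hc))
  obtain ⟨l, hl, hl1, hl2⟩ := ih _ (Finset.card_lt_card hFv) hF rfl
  obtain ⟨r, hr, hr1, hr2⟩ := ih _ (Finset.card_lt_card hGv) hG rfl
  subst hl hr
  exact ⟨.node Φ x l r, rfl, ⟨hc, hsp, hl1, hr1⟩, hl2, hr2⟩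

/-! ### Functions that are computed in polynomial time -/

theorem eval_le_eval (p : Polynomial ℕ) {m n : ℕ} (h : m ≤ n) : p.eval m ≤ p.eval n := by
  rw [Polynomial.eval_eq_sum, Polynomial.eval_eq_sum]
  exact Finset.sum_le_sum fun i _ => Nat.mul_le_mul_left _ (Nat.pow_le_pow_left h i)

theorem Data.one_le_size (d : Data) : 1 ≤ d.size := by
  cases d <;> simp [Data.size]

theorem Data.size_cons (a b : Data) : (Data.cons a b).size = a.size + b.size + 1 := rfl

theorem Data.size_hd_le (d : Data) : d.hd.size ≤ d.size := by
  cases d <;> simp only [Data.hd, Data.size] <;> omega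

theorem Data.size_tl_le (d : Data) : d.tl.size ≤ d.size := by
  cases d <;> simp only [Data.tl, Data.size] <;> omega

theorem Prog.Run.size_le {P : Prog} {d e : Data} {t : ℕ} (h : P.Run d e t) : e.size ≤ t := by
  induction h <;> (try simp only [Data.size] at *) <;> omega

/-- Some program computes `f` at a cost that is polynomial in the size of the argument. -/
def PolyTime (f : Data → Data) : Prop :=
  ∃ (P : Prog) (p : Polynomial ℕ), ∀ d, ∃ t, P.Run d (f d) t ∧ t ≤ p.eval d.size

theorem PolyTime.exists_size_le {f : Data → Data} (hf : PolyTime f) :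
    ∃ p : Polynomial ℕ, ∀ d, (f d).size ≤ p.eval d.size := by
  obtain ⟨P, p, h⟩ := hf
  refine ⟨p, fun d => ?_⟩
  obtain ⟨t, hr, ht⟩ := h d
  exact hr.size_le.trans ht

theorem PolyTime.id : PolyTime fun d => d :=
  ⟨.id, .X + .X, fun d => ⟨_, .id d, by simp⟩⟩

theorem PolyTime.const_nil : PolyTime fun _ => .nil :=
  ⟨.nil, .X + 1, fun d => ⟨_, .nil d, by simp⟩⟩

theorem PolyTime.comp {f g : Data → Data} (hg : PolyTime g) (hf : PolyTime f) :
    PolyTime fun d => g (f d) := by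
  obtain ⟨P, p, hP⟩ := hf
  obtain ⟨Q, q, hQ⟩ := hg
  refine ⟨.comp P Q, p + q.comp p + 1, fun d => ?_⟩
  obtain ⟨s, hs, hsp⟩ := hP d
  obtain ⟨t, ht, htq⟩ := hQ (f d)
  refine ⟨_, .comp hs ht, ?_⟩
  have := eval_le_eval q (hs.size_le.trans hsp)
  simp only [Polynomial.eval_add, Polynomial.eval_comp, Polynomial.eval_one]
  omega

theorem PolyTime.hd {f : Data → Data} (hf : PolyTime f) : PolyTime fun d => (f d).hd :=
  PolyTime.comp (g := Data.hd) ⟨.hd, .X + .X, fun d => ⟨_, .hd d, by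
    have := d.size_hd_le
    simp only [Polynomial.eval_add, Polynomial.eval_X]
    omega⟩⟩ hf

theorem PolyTime.tl {f : Data → Data} (hf : PolyTime f) : PolyTime fun d => (f d).tl :=
  PolyTime.comp (g := Data.tl) ⟨.tl, .X + .X, fun d => ⟨_, .tl d, by
    have := d.size_tl_le
    simp only [Polynomial.eval_add, Polynomial.eval_X]
    omega⟩⟩ hf

theorem PolyTime.cons {f g : Data → Data} (hf : PolyTime f) (hg : PolyTime g) :
    PolyTime fun d => .cons (f d) (g d) := by
  obtain ⟨P, p, hP⟩ := hf
  obtain ⟨Q, q, hQ⟩ := hg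
  refine ⟨.pair P Q, p + q + .X + (p + q + 1), fun d => ?_⟩
  obtain ⟨s, hs, hsp⟩ := hP d
  obtain ⟨t, ht, htq⟩ := hQ d
  refine ⟨_, .pair hs ht, ?_⟩
  have h1 := hs.size_le
  have h2 := ht.size_le
  simp only [Polynomial.eval_add, Polynomial.eval_X, Polynomial.eval_one, Data.size_cons]
  omega

theorem PolyTime.const (c : Data) : PolyTime fun _ => c := by
  induction c with
  | nil => exact .const_nil
  | cons a b iha ihb => exact iha.cons ihb

open Classical in
theorem PolyTime.ite {c f g : Data → Data} (hc : PolyTime c) (hf : PolyTime f) (hg : PolyTime g) :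
    PolyTime fun d => if c d = .nil then g d else f d := by
  obtain ⟨C, r, hC⟩ := hc
  obtain ⟨P, p, hP⟩ := hf
  obtain ⟨Q, q, hQ⟩ := hg
  refine ⟨.ite C P Q, r + p + q + .X + (r + 1), fun d => ?_⟩
  obtain ⟨u, hu, hur⟩ := hC d
  obtain ⟨s, hs, hsp⟩ := hP d
  obtain ⟨t, ht, htq⟩ := hQ d
  have h1 := hu.size_le
  simp only [Polynomial.eval_add, Polynomial.eval_X, Polynomial.eval_one]
  by_cases h : c d = .nil
  · rw [h] at hu
    rw [if_pos h]
    exact ⟨_, .ite_false hu ht, by omega⟩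
  · rw [if_neg h]
    exact ⟨_, .ite_true hu h hs, by omega⟩

open Classical in
theorem PolyTime.ite_eq {a b f g : Data → Data} (ha : PolyTime a) (hb : PolyTime b)
    (hf : PolyTime f) (hg : PolyTime g) :
    PolyTime fun d => if a d = b d then f d else g d := by
  have heq : PolyTime fun d => .ofBool (decide (d.hd = d.tl)) := by
    refine ⟨.eq, .X + 3, fun d => ?_⟩
    by_cases h : d.hd = d.tl
    · exact ⟨_, by simpa [h] using Prog.Run.eq_true d h, by simp [Data.ofBool, Data.size]⟩
    · exact ⟨_, by simpa [h] using Prog.Run.eq_false d h, by simp [Data.ofBool, Data.size]⟩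
  have := (heq.comp (ha.cons hb)).ite hf hg
  convert this using 2 with d
  by_cases h : a d = b d <;> simp [h, Data.hd, Data.tl, Data.ofBool]

/-- A datum read as a list. -/
def Data.toList : Data → List Data
  | .nil => []
  | .cons a b => a :: b.toList

theorem Data.size_lt_of_mem {d e : Data} (h : e ∈ d.toList) : e.size < d.size := by
  induction d with
  | nil => simp [Data.toList] at h
  | cons a b _ ih =>
    rw [Data.size_cons]
    rcases List.mem_cons.1 h with rfl | h
    · omega
    · have := ih h
      omega

theorem Data.length_toList_lt (d : Data) : d.toList.length < d.size := by
  induction d with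
  | nil => simp [Data.toList, Data.size]
  | cons a b _ ih =>
    rw [Data.size_cons, Data.toList, List.length_cons]
    omega

/-- The loop over a list that keeps a parameter and an accumulator, with the body `P`. -/
def Prog.fold (P : Prog) : Prog :=
  .loop .hd (.pair (.comp .hd .tl) (.pair (.comp .tl .hd)
    (.comp (.pair (.comp .tl .hd) (.pair (.comp .tl .tl) (.comp .hd .hd))) P)))

theorem run_foldl {step : Data → Data → Data → Data} {P : Prog} {p : Polynomial ℕ}
    (hP : ∀ d, ∃ t, P.Run d (step d.hd d.tl.hd d.tl.tl) t ∧ t ≤ p.eval d.size)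
    (d : Data) (N : ℕ) (l : Data) (a : Data) (hl : l.size ≤ N) (hd : d.size ≤ N)
    (hN : ∀ L, L <+: l.toList → (L.foldl (step d) a).size ≤ N) :
    ∃ t r, P.fold.Run (.cons l (.cons d a)) r t ∧ r.tl.tl = l.toList.foldl (step d) a ∧
      t ≤ l.toList.length * (p.eval (3 * N + 2) + 100 * (N + 1)) + 100 * (N + 1) := by
  induction l generalizing a with
  | nil =>
    have ha : a.size ≤ N := hN [] List.nil_prefix
    refine ⟨_, _, Prog.Run.loop_stop (Prog.Run.hd _), rfl, ?_⟩
    simp only [Data.hd, Data.size] at *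
    omega
  | cons e l _ ih =>
    have ha : a.size ≤ N := hN [] List.nil_prefix
    have hb : (step d a e).size ≤ N := hN [e] (by simp [Data.toList])
    obtain ⟨s, hs, hsp⟩ := hP (.cons d (.cons a e))
    -- The body reads the parameter, the accumulator and one entry, joined by two pairs. The terms
    -- with 100 in the bound are generous room for the bookkeeping of a round.
    have hsz : (Data.cons d (.cons a e)).size ≤ 3 * N + 2 := by
      simp only [Data.size_cons] at *
      omega
    have hsp' := hsp.trans (eval_le_eval p hsz)
    rw [Data.size_cons] at hl
    obtain ⟨t, r, ht, hr, hbd⟩ := ih (step d a e) (by omega) (fun L hL => hN (e :: L) (by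
      simpa [Data.toList] using hL))
    refine ⟨_, r, .loop_step (.hd _) (by simp [Data.hd]) (.pair (.comp (.hd _) (.tl _))
      (.pair (.comp (.tl _) (.hd _)) (.comp (.pair (.comp (.tl _) (.hd _))
        (.pair (.comp (.tl _) (.tl _)) (.comp (.hd _) (.hd _)))) hs))) ht, ?_, ?_⟩
    · rw [hr]; rfl
    · simp only [Data.size_cons, Data.hd, Data.tl, Data.toList, List.length_cons, Nat.succ_mul] at *
      omega

/-- The bound on intermediate accumulators is essential: iterating a polynomial step, such as
doubling, may produce data of exponential size. -/
theorem PolyTime.foldl {step : Data → Data → Data → Data} {f g : Data → Data}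
    (hs : PolyTime fun d => step d.hd d.tl.hd d.tl.tl) (hf : PolyTime f) (hg : PolyTime g)
    (hB : ∃ B : Polynomial ℕ, ∀ d L, L <+: (g d).toList →
      (L.foldl (step d) (f d)).size ≤ B.eval d.size) :
    PolyTime fun d => (g d).toList.foldl (step d) (f d) := by
  obtain ⟨P, p, hP⟩ := hs
  obtain ⟨q, hq⟩ := hg.exists_size_le
  obtain ⟨B, hB⟩ := hB
  obtain ⟨Q, r, hQ⟩ := hg.cons (PolyTime.id.cons hf)
  -- Factor 5: besides the cost of the loop there are four reads or writes while the accumulator is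
  -- extracted, each of a datum no larger than that cost.
  refine ⟨.comp Q (.comp P.fold (.comp .tl .tl)), r + 5 * (q * (p.comp (3 * (q + .X + B) + 2)
      + 100 * ((q + .X + B) + 1)) + 100 * ((q + .X + B) + 1)) + 3, fun d => ?_⟩
  · set N := q.eval d.size + d.size + B.eval d.size with hN
    obtain ⟨s, hs, hsr⟩ := hQ d
    obtain ⟨t, e, ht, he, hte⟩ := run_foldl hP d N (g d) (f d) ((hq d).trans (by omega)) (by omega)
      fun L hL => (hB d L hL).trans (by omega)
    have h := Prog.Run.comp hs (.comp ht (.comp (.tl e) (.tl e.tl)))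
    rw [he] at h
    refine ⟨_, h, ?_⟩
    have h1 := (g d).length_toList_lt
    have h2 := hq d
    have h3 : (g d).toList.length * (p.eval (3 * N + 2) + 100 * (N + 1)) ≤
      q.eval d.size * (p.eval (3 * N + 2) + 100 * (N + 1)) := Nat.mul_le_mul_right _ (by omega)
    have h4 := ht.size_le
    have h5 := e.size_tl_le
    have h6 := e.tl.size_tl_le
    rw [he] at h6
    generalize hM : q.eval d.size * (p.eval (3 * N + 2) + 100 * (N + 1)) = M at *
    have h7 : s + (t + (e.size + e.tl.size + (e.tl.size + ((g d).toList.foldl (step d) (f d)).size)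
      + 1) + 1) + 1 ≤ r.eval d.size + 5 * (M + 100 * (N + 1)) + 3 := by omega
    refine h7.trans (le_of_eq ?_)
    simp [← hM, hN]

/-- The case that a step enlarges the accumulator by a bounded amount. -/
theorem PolyTime.foldl_of_add {step : Data → Data → Data → Data} {f g : Data → Data}
    (hs : PolyTime fun d => step d.hd d.tl.hd d.tl.tl) (hf : PolyTime f) (hg : PolyTime g)
    (hB : ∃ q : Polynomial ℕ, ∀ d a e,
      (step d a e).size ≤ a.size + q.eval (d.size + e.size)) :
    PolyTime fun d => (g d).toList.foldl (step d) (f d) := by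
  refine hs.foldl hf hg ?_
  obtain ⟨q, hq⟩ := hB
  obtain ⟨p, hp⟩ := hf.exists_size_le
  obtain ⟨r, hr⟩ := hg.exists_size_le
  refine ⟨p + r * q.comp (.X + r), fun d L hL => ?_⟩
  have key : ∀ L : List Data, ∀ a, (∀ e ∈ L, e.size ≤ r.eval d.size) → (L.foldl (step d) a).size ≤
      a.size + L.length * q.eval (d.size + r.eval d.size) := by
    intro L
    induction L with
    | nil => simp
    | cons e L ih =>
      intro a he
      have h1 := ih (step d a e) fun x hx => he x (List.mem_cons_of_mem _ hx)
      have h2 := hq d a e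
      have h3 := eval_le_eval q (Nat.add_le_add_left (he e List.mem_cons_self) d.size)
      simp only [List.foldl_cons, List.length_cons, Nat.succ_mul] at *
      omega
  refine (key L (f d) fun e he => (Data.size_lt_of_mem (hL.subset he)).le.trans (hr d)).trans ?_
  have h1 := hL.length_le
  have h2 := (g d).length_toList_lt
  have h3 := hr d
  have h4 : L.length * q.eval (d.size + r.eval d.size) ≤
    r.eval d.size * q.eval (d.size + r.eval d.size) := Nat.mul_le_mul_right _ (by omega)
  have h5 := hp d
  simp only [Polynomial.eval_add, Polynomial.eval_mul, Polynomial.eval_comp, Polynomial.eval_X]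
  omega

noncomputable section

/-! ### The elimination procedure on data -/

/-- The elements of `a`, in reverse order, in front of `b`. -/
def Data.appendRev (a b : Data) : Data :=
  a.toList.foldl (fun r e => .cons e r) b

open Classical in
/-- The elements of `a` with the property `p`, in reverse order. -/
def Data.filter (p : Data → Prop) (a : Data) : Data :=
  a.toList.foldl (fun r e => if p e then .cons e r else r) .nil

theorem Data.toList_appendRev (a b : Data) :
    (a.appendRev b).toList = a.toList.reverse ++ b.toList := by
  have key : ∀ (L : List Data) (r : Data),
      (L.foldl (fun r e => Data.cons e r) r).toList = L.reverse ++ r.toList := by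
    intro L
    induction L with
    | nil => simp
    | cons e L ih => intro r; simp [ih, Data.toList]
  exact key _ _

theorem Data.size_appendRev (a b : Data) : (a.appendRev b).size + 1 = a.size + b.size := by
  induction a generalizing b with
  | nil => simp [appendRev, toList, size, Nat.add_comm]
  | cons e a _ ih =>
    have := ih (.cons e b)
    simp only [size_cons] at *
    rw [show (Data.cons e a).appendRev b = a.appendRev (.cons e b) from rfl]
    omega

open Classical in
theorem Data.toList_filter (p : Data → Prop) (a : Data) :
    (a.filter p).toList = (a.toList.filter p).reverse := by
  have key : ∀ (L : List Data) (r : Data),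
      (L.foldl (fun r e => if p e then Data.cons e r else r) r).toList =
        (L.filter p).reverse ++ r.toList := by
    intro L
    induction L with
    | nil => simp
    | cons e L ih =>
      intro r
      by_cases h : p e <;> simp [ih, h, Data.toList]
  exact (key a.toList .nil).trans (List.append_nil _)

theorem Data.size_filter_add (p : Data → Prop) (a : Data) :
    (a.filter p).size + (a.filter fun e => ¬ p e).size = a.size + 1 := by
  classical
  have key : ∀ (a r s : Data),
      (a.toList.foldl (fun r e => if p e then Data.cons e r else r) r).size +
      (a.toList.foldl (fun r e => if ¬ p e then Data.cons e r else r) s).size + 1 =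
        a.size + r.size + s.size := by
    intro a
    induction a with
    | nil => intro r s; simp only [toList, List.foldl_nil, size]; omega
    | cons e a _ ih =>
      intro r s
      by_cases h : p e
      · have := ih (.cons e r) s
        simp only [toList, List.foldl_cons, size_cons, h, if_true, not_true, if_false] at *
        omega
      · have := ih r (.cons e s)
        simp only [toList, List.foldl_cons, size_cons, h, if_true, not_false_iff, if_false] at *
        omega
  have h := key a .nil .nil
  have hn : (a.filter fun e => ¬ p e) =
      a.toList.foldl (fun r e => if ¬ p e then Data.cons e r else r) .nil := by
    unfold filter
    congr!
  rw [hn, filter]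
  simp only [size] at h
  omega

theorem Data.size_filter_le (p : Data → Prop) (a : Data) : (a.filter p).size ≤ a.size := by
  have h1 := a.size_filter_add p
  have h2 := (a.filter fun e => ¬ p e).one_le_size
  omega

def litData (v : Data) (b : Bool) : Data :=
  .cons v (.ofBool b)

def resolventData (v c d : Data) : Data :=
  (c.filter fun e => e ≠ litData v true).appendRev (d.filter fun e => e ≠ litData v false)

def having (l F : Data) : Data :=
  F.filter fun c => l ∈ c.toList

def lacking (l F : Data) : Data :=
  F.filter fun c => ¬ l ∈ c.toList

/-- The clauses with the literal `v`. -/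
def posData (v F : Data) : Data :=
  having (litData v true) F

/-- The clauses with the literal `¬ v` but not `v`. -/
def negData (v F : Data) : Data :=
  having (litData v false) (lacking (litData v true) F)

def othersData (v F : Data) : Data :=
  lacking (litData v false) (lacking (litData v true) F)

/-- The result of the elimination of `v`: the new formula and the extended list of steps. -/
def eliminateData (v F O : Data) : Data :=
  .cons (.cons (resolventData v (posData v F).hd (negData v F).hd) (othersData v F))
    (.cons (.cons v (.cons (posData v F).hd (.cons (negData v F).hd
      (resolventData v (posData v F).hd (negData v F).hd)))) O)

open Classical in
/-- Eliminate the variable of the literal `e`, if it occurs once in each sign. -/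
def tryEliminate (s e : Data) : Data :=
  if posData e.hd s.hd = .cons (posData e.hd s.hd).hd .nil then
    if negData e.hd s.hd = .cons (negData e.hd s.hd).hd .nil then
      eliminateData e.hd s.hd s.tl
    else s
  else s

def literalsData (F : Data) : Data :=
  F.toList.foldl (fun a c => c.appendRev a) .nil

/-- As many copies of the list of all literals as there are clauses. -/
def schedule (F : Data) : Data :=
  F.toList.foldl (fun a _ => (literalsData F).appendRev a) .nil

def refutationData (F : Data) : Data :=
  ((schedule F).toList.foldl tryEliminate (.cons F .nil)).tl.appendRev .nil

/-! ### The cost of the elimination procedure -/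

theorem PolyTime.appendRev {f g : Data → Data} (hf : PolyTime f) (hg : PolyTime g) :
    PolyTime fun d => (f d).appendRev (g d) := by
  refine PolyTime.foldl_of_add (step := fun _ a e => .cons e a) ?_ hg hf ⟨.X + 1, fun d a e => ?_⟩
  · exact PolyTime.id.tl.tl.cons PolyTime.id.tl.hd
  · simp only [Data.size_cons, Polynomial.eval_add, Polynomial.eval_X, Polynomial.eval_one]
    omega

theorem PolyTime.filter {p : Data → Data → Prop} {t g : Data → Data} (ht : PolyTime t)
    (hp : ∀ d e, p d e ↔ t (.cons d e) ≠ .nil) (hg : PolyTime g) :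
    PolyTime fun d => (g d).filter (p d) := by
  classical
  refine PolyTime.foldl_of_add (step := fun d a e => if p d e then .cons e a else a) ?_
    .const_nil hg ⟨.X + 1, fun d a e => ?_⟩
  · have := (ht.comp (PolyTime.id.hd.cons PolyTime.id.tl.tl)).ite
      (PolyTime.id.tl.tl.cons PolyTime.id.tl.hd) PolyTime.id.tl.hd
    convert this using 2 with d
    by_cases h : p d.hd d.tl.tl
    · rw [if_pos h, if_neg ((hp _ _).1 h)]
    · rw [if_neg h, if_pos (not_not.1 fun hn => h ((hp _ _).2 hn))]
  · simp only [Polynomial.eval_add, Polynomial.eval_X, Polynomial.eval_one]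
    split
    · rw [Data.size_cons]
      omega
    · omega

open Classical in
/-- Does `l` occur in the list `c`? -/
def memData (l c : Data) : Data :=
  c.toList.foldl (fun r e => if e = l then .cons .nil .nil else r) .nil

theorem memData_ne_nil (l c : Data) : memData l c ≠ .nil ↔ l ∈ c.toList := by
  classical
  have key : ∀ (L : List Data) (r : Data),
      L.foldl (fun r e => if e = l then Data.cons .nil .nil else r) r ≠ .nil ↔
        l ∈ L ∨ r ≠ .nil := by
    intro L
    induction L with
    | nil => simp
    | cons e L ih =>
      intro r
      rw [List.foldl_cons, ih, List.mem_cons]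
      by_cases h : e = l
      · simp [h]
      · simp [h, Ne.symm h]
  exact (key c.toList .nil).trans (by simp)

theorem PolyTime.mem {f g : Data → Data} (hf : PolyTime f) (hg : PolyTime g) :
    PolyTime fun d => memData (f d) (g d) := by
  classical
  have : PolyTime fun d => memData d.hd d.tl := by
    refine PolyTime.foldl_of_add (step := fun d a e => if e = d.hd then .cons .nil .nil else a) ?_
      .const_nil PolyTime.id.tl ⟨3, fun d a e => ?_⟩
    · exact PolyTime.id.tl.tl.ite_eq PolyTime.id.hd.hd (.const _) PolyTime.id.tl.hd
    · simp only [Polynomial.eval_ofNat]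
      split
      · simp only [Data.size]
        omega
      · omega
  exact this.comp (hf.cons hg)

theorem PolyTime.having {f g : Data → Data} (hf : PolyTime f) (hg : PolyTime g) :
    PolyTime fun d => having (f d) (g d) :=
  PolyTime.filter (p := fun d c => f d ∈ c.toList) ((hf.comp PolyTime.id.hd).mem PolyTime.id.tl)
    (fun _ _ => (memData_ne_nil _ _).symm) hg

theorem PolyTime.lacking {f g : Data → Data} (hf : PolyTime f) (hg : PolyTime g) :
    PolyTime fun d => lacking (f d) (g d) := by
  classical
  refine PolyTime.filter (p := fun d c => ¬ f d ∈ c.toList)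
    (((hf.comp PolyTime.id.hd).mem PolyTime.id.tl).ite .const_nil (.const (.cons .nil .nil)))
    (fun d e => ?_) hg
  rw [← memData_ne_nil, not_not]
  by_cases h : memData (f d) e = .nil <;> simp [h, Data.hd, Data.tl]

theorem PolyTime.remove {f g : Data → Data} (hf : PolyTime f) (hg : PolyTime g) :
    PolyTime fun d => (g d).filter fun e => e ≠ f d := by
  classical
  refine PolyTime.filter (p := fun d e => e ≠ f d)
    (PolyTime.id.tl.ite_eq (hf.comp PolyTime.id.hd) .const_nil (.const (.cons .nil .nil)))
    (fun d e => ?_) hg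
  by_cases h : e = f d <;> simp [h, Data.hd, Data.tl]

theorem PolyTime.litData {f : Data → Data} (hf : PolyTime f) (b : Bool) :
    PolyTime fun d => litData (f d) b :=
  hf.cons (.const _)

theorem PolyTime.tryEliminate {f g : Data → Data} (hf : PolyTime f) (hg : PolyTime g) :
    PolyTime fun d => tryEliminate (f d) (g d) := by
  have hF := hf.hd
  have hv := hg.hd
  have hp := (hv.litData true).having hF
  have hn := (hv.litData false).having ((hv.litData true).lacking hF)
  have ho := (hv.litData false).lacking ((hv.litData true).lacking hF)
  have hr := ((hv.litData true).remove hp.hd).appendRev ((hv.litData false).remove hn.hd)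
  exact hp.ite_eq (hp.hd.cons .const_nil) (hn.ite_eq (hn.hd.cons .const_nil)
    ((hr.cons ho).cons ((hv.cons (hp.hd.cons (hn.hd.cons hr))).cons hf.tl)) hf) hf

/-- `posData`, `negData` and `othersData` partition the list for arbitrary data, and the resolvent
is no longer than its two parents together, which are removed. So the formula never grows, although
repeated literals are not merged, and only the list of steps gains a bounded amount. -/
theorem size_tryEliminate (s e : Data) : (tryEliminate s e).hd.size ≤ s.hd.size ∧
    (tryEliminate s e).tl.size ≤ s.tl.size + (e.size + 3 * s.hd.size + 10) := by
  rw [tryEliminate]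
  split
  case isFalse => exact ⟨le_rfl, by omega⟩
  case isTrue hp =>
    split
    case isFalse => exact ⟨le_rfl, by omega⟩
    case isTrue hn =>
      have h1 := s.hd.size_filter_add fun c => litData e.hd true ∈ c.toList
      have h2 := (lacking (litData e.hd true) s.hd).size_filter_add
        fun c => litData e.hd false ∈ c.toList
      have h3 := (((posData e.hd s.hd).hd.filter fun x => x ≠ litData e.hd true)).size_appendRev
        ((negData e.hd s.hd).hd.filter fun x => x ≠ litData e.hd false)
      have h4 := (posData e.hd s.hd).hd.size_filter_le fun x => x ≠ litData e.hd true
      have h5 := (negData e.hd s.hd).hd.size_filter_le fun x => x ≠ litData e.hd false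
      change (posData e.hd s.hd).size + (lacking (litData e.hd true) s.hd).size = _ at h1
      change (negData e.hd s.hd).size + (othersData e.hd s.hd).size = _ at h2
      change (resolventData e.hd (posData e.hd s.hd).hd (negData e.hd s.hd).hd).size + 1 = _ at h3
      have h6 := congrArg Data.size hp
      have h7 := congrArg Data.size hn
      have h8 := e.size_hd_le
      have h9 := (othersData e.hd s.hd).one_le_size
      simp only [eliminateData, Data.hd, Data.tl, Data.size] at *
      omega

theorem PolyTime.literalsData : PolyTime literalsData := by
  refine PolyTime.foldl_of_add (step := fun _ a e => e.appendRev a)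
    (PolyTime.id.tl.tl.appendRev PolyTime.id.tl.hd) .const_nil PolyTime.id
    ⟨.X, fun d a e => ?_⟩
  have := e.size_appendRev a
  rw [Polynomial.eval_X]
  omega

theorem PolyTime.schedule : PolyTime schedule := by
  obtain ⟨p, hp⟩ := PolyTime.literalsData.exists_size_le
  refine PolyTime.foldl_of_add (step := fun d a _ => (ReadOnce.literalsData d).appendRev a)
    ((PolyTime.literalsData.comp PolyTime.id.hd).appendRev PolyTime.id.tl.hd) .const_nil PolyTime.id
    ⟨p, fun d a e => ?_⟩
  have h1 := (ReadOnce.literalsData d).size_appendRev a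
  have h2 := (hp d).trans (eval_le_eval p (Nat.le_add_right d.size e.size))
  omega

theorem size_foldl_tryEliminate {L : List Data} {M : ℕ} (hM : ∀ e ∈ L, e.size ≤ M) (s : Data) :
    (L.foldl tryEliminate s).hd.size ≤ s.hd.size ∧
    (L.foldl tryEliminate s).tl.size ≤ s.tl.size + L.length * (M + 3 * s.hd.size + 10) := by
  induction L generalizing s with
  | nil => simp
  | cons e L ih =>
    obtain ⟨h1, h2⟩ := ih (fun x hx => hM x (List.mem_cons_of_mem _ hx)) (tryEliminate s e)
    obtain ⟨h3, h4⟩ := size_tryEliminate s e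
    have h5 := hM e List.mem_cons_self
    have h6 : L.length * (M + 3 * (tryEliminate s e).hd.size + 10) ≤
      L.length * (M + 3 * s.hd.size + 10) := Nat.mul_le_mul_left _ (by omega)
    rw [List.foldl_cons, List.length_cons, Nat.succ_mul L.length]
    omega

theorem Data.size_le_hd_add_tl (d : Data) : d.size ≤ d.hd.size + d.tl.size + 1 := by
  cases d <;> simp [Data.size, Data.hd, Data.tl]

theorem PolyTime.refutationData : PolyTime refutationData := by
  obtain ⟨p, hp⟩ := PolyTime.schedule.exists_size_le
  have : PolyTime fun d =>
      ((ReadOnce.schedule d).toList.foldl ReadOnce.tryEliminate (.cons d .nil)) := by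
    refine PolyTime.foldl (step := fun _ a e => ReadOnce.tryEliminate a e)
      (PolyTime.id.tl.hd.tryEliminate PolyTime.id.tl.tl) (PolyTime.id.cons .const_nil)
      -- The formula stays below the input size; `p` bounds both the number of trials and the size
      -- of each scheduled literal, hence the growth of the list of steps.
      PolyTime.schedule ⟨.X + (1 + p * (p + 3 * .X + 10)) + 1, fun d L hL => ?_⟩
    have h1 := hp d
    obtain ⟨h2, h3⟩ := size_foldl_tryEliminate
      (fun e he => (Data.size_lt_of_mem (hL.subset he)).le.trans h1) (.cons d .nil)
    have h4 := (L.foldl ReadOnce.tryEliminate (.cons d .nil)).size_le_hd_add_tl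
    have h5 := hL.length_le
    have h6 := (ReadOnce.schedule d).length_toList_lt
    have h7 : L.length * (p.eval d.size + 3 * d.size + 10) ≤
      p.eval d.size * (p.eval d.size + 3 * d.size + 10) := Nat.mul_le_mul_right _ (by omega)
    change _ ≤ d.size at h2
    change _ ≤ 1 + L.length * (p.eval d.size + 3 * d.size + 10) at h3
    change (L.foldl ReadOnce.tryEliminate (.cons d .nil)).size ≤ _
    simp only [Polynomial.eval_add, Polynomial.eval_mul, Polynomial.eval_X, Polynomial.eval_one,
      Polynomial.eval_ofNat]
    omega
  exact this.tl.appendRev .const_nil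

end

/-! ### The elimination procedure is correct -/

theorem repList_iff {α : Type} {rep : Data → α → Prop} {d : Data} {l : List α} :
    RepList rep d l ↔ List.Forall₂ rep d.toList l := by
  induction d generalizing l with
  | nil => cases l <;> simp [RepList, Data.toList]
  | cons a b _ ih => cases l <;> simp [RepList, Data.toList, ih]

theorem exists_of_mem_left {α β : Type*} {r : α → β → Prop} {l : List α} {m : List β}
    (h : List.Forall₂ r l m) {a : α} (ha : a ∈ l) : ∃ b ∈ m, r a b := by
  induction h with
  | nil => simp at ha
  | cons hab _ ih =>
    rcases List.mem_cons.1 ha with rfl | ha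
    · exact ⟨_, List.mem_cons_self, hab⟩
    · exact (ih ha).imp fun b hb => ⟨List.mem_cons_of_mem _ hb.1, hb.2⟩

theorem exists_of_mem_right {α β : Type*} {r : α → β → Prop} {l : List α} {m : List β}
    (h : List.Forall₂ r l m) {b : β} (hb : b ∈ m) : ∃ a ∈ l, r a b :=
  exists_of_mem_left h.flip hb

theorem bits_inj {m n : ℕ} (h : m.bits = n.bits) : m = n := by
  have key : ∀ n : ℕ, n.bits.foldr Nat.bit 0 = n := by
    intro n
    induction n using Nat.binaryRec' with
    | zero => simp
    | bit b n hn ih => rw [Nat.bits_append_bit _ _ hn, List.foldr_cons, ih]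
  rw [← key m, h, key]

theorem RepBool.inj {d : Data} {a b : Bool} (ha : RepBool d a) (hb : RepBool d b) : a = b := by
  unfold RepBool at ha hb
  cases a <;> cases b <;> simp_all [Data.ofBool]

theorem RepVar.inj {d : Data} {x y : ℕ} (hx : RepVar d x) (hy : RepVar d y) : x = y := by
  unfold RepVar at hx hy
  refine bits_inj ?_
  generalize x.bits = L at *
  generalize y.bits = M at *
  induction d generalizing L M with
  | nil => cases L <;> cases M <;> simp_all [RepList]
  | cons a b _ ih =>
    cases L with
    | nil => exact hx.elim
    | cons u L =>
      cases M with
      | nil => exact hy.elim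
      | cons v M => rw [hx.1.inj hy.1, ih L hx.2 M hy.2]

theorem RepVar.unique {d e : Data} {x : ℕ} (hd : RepVar d x) (he : RepVar e x) : d = e := by
  unfold RepVar at hd he
  generalize x.bits = L at *
  induction L generalizing d e with
  | nil =>
    cases d
    · cases e
      · rfl
      · exact he.elim
    · exact hd.elim
  | cons b L ih =>
    cases d
    · exact hd.elim
    · cases e
      · exact he.elim
      · rw [ih hd.2 he.2, show _ = _ from hd.1, show _ = _ from he.1]

/-- Literals, unlike clauses, have exactly one representation, so the equality test of programs
decides equality of literals. -/
theorem RepLiteral.biUnique : Relator.BiUnique RepLiteral := by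
  constructor
  · rintro _ _ l ⟨a, b, rfl, ha, hb⟩ ⟨a', b', rfl, ha', hb'⟩
    rw [ha.unique ha', show b = _ from hb, show b' = _ from hb']
  · rintro _ l m ⟨a, b, rfl, ha, hb⟩ ⟨a', b', he, ha', hb'⟩
    obtain ⟨rfl, rfl⟩ := Data.cons.inj he
    exact Prod.ext (ha.inj ha') (hb.inj hb')

theorem repLiteral_litData {v : Data} {x : ℕ} (hv : RepVar v x) (b : Bool) :
    RepLiteral (litData v b) (x, b) :=
  ⟨v, _, rfl, hv, rfl⟩

theorem RepClause.exists_forall₂ {c : Data} {C : Clause} (h : RepClause c C) :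
    ∃ L : List Literal, L.toFinset = C ∧ List.Forall₂ RepLiteral c.toList L := by
  obtain ⟨L, hL, h⟩ := h
  exact ⟨L, hL, repList_iff.1 h⟩

theorem RepClause.mem_iff {c e : Data} {C : Clause} {l : Literal} (h : RepClause c C)
    (he : RepLiteral e l) : e ∈ c.toList ↔ l ∈ C := by
  obtain ⟨L, rfl, hL⟩ := h.exists_forall₂
  rw [List.mem_toFinset]
  exact List.rel_mem RepLiteral.biUnique he hL

theorem RepClause.erase {c e : Data} {C : Clause} {l : Literal} (h : RepClause c C)
    (he : RepLiteral e l) : RepClause (c.filter fun x => x ≠ e) (C.erase l) := by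
  classical
  obtain ⟨L, rfl, hL⟩ := h.exists_forall₂
  refine ⟨(L.filter fun m => m ≠ l).reverse, by ext; simp [and_comm], repList_iff.2 ?_⟩
  rw [Data.toList_filter]
  refine List.rel_reverse (List.rel_filter (fun x m hx => ?_) hL)
  simp only [decide_eq_true_eq]
  exact not_congr ⟨fun h => RepLiteral.biUnique.2 hx (h ▸ he),
    fun h => RepLiteral.biUnique.1 hx (h ▸ he)⟩

theorem RepClause.union {c d : Data} {C D : Clause} (hc : RepClause c C) (hd : RepClause d D) :
    RepClause (c.appendRev d) (C ∪ D) := by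
  obtain ⟨L, rfl, hL⟩ := hc.exists_forall₂
  obtain ⟨M, rfl, hM⟩ := hd.exists_forall₂
  refine ⟨L.reverse ++ M, by ext; simp, repList_iff.2 ?_⟩
  rw [Data.toList_appendRev]
  exact List.rel_append (List.rel_reverse hL) hM

theorem RepCNF.exists_forall₂ {F : Data} {Φ : CNF} (h : RepCNF F Φ) :
    ∃ L : List Clause, L.Nodup ∧ L.toFinset = Φ ∧ List.Forall₂ RepClause F.toList L := by
  obtain ⟨L, hn, hL, h⟩ := h
  exact ⟨L, hn, hL, repList_iff.1 h⟩

theorem RepCNF.length_toList {F : Data} {Φ : CNF} (h : RepCNF F Φ) : F.toList.length = Φ.card := by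
  obtain ⟨L, hn, rfl, hL⟩ := h.exists_forall₂
  rw [hL.length_eq, List.toFinset_card_of_nodup hn]

theorem RepCNF.filter {F : Data} {Φ : CNF} (h : RepCNF F Φ) {p : Data → Prop} {q : Clause → Prop}
    [DecidablePred q] (hpq : ∀ c C, RepClause c C → (p c ↔ q C)) :
    RepCNF (F.filter p) (Φ.filter q) := by
  classical
  obtain ⟨L, hn, rfl, hL⟩ := h.exists_forall₂
  refine ⟨(L.filter q).reverse, List.nodup_reverse.2 (hn.filter _), by ext; simp,
    repList_iff.2 ?_⟩
  rw [Data.toList_filter]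
  refine List.rel_reverse (List.rel_filter (fun c C hc => ?_) hL)
  simpa using hpq c C hc

theorem RepCNF.having {F e : Data} {Φ : CNF} {l : Literal} (h : RepCNF F Φ) (he : RepLiteral e l) :
    RepCNF (having e F) (Φ.filter fun C => l ∈ C) :=
  h.filter fun _ _ hc => hc.mem_iff he

theorem RepCNF.lacking {F e : Data} {Φ : CNF} {l : Literal} (h : RepCNF F Φ)
    (he : RepLiteral e l) : RepCNF (lacking e F) (Φ.filter fun C => l ∉ C) :=
  h.filter fun _ _ hc => not_congr (hc.mem_iff he)

/-- Justifies the test in `tryEliminate`: each clause is listed once, so a list of length one means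
a single clause. -/
theorem RepCNF.eq_cons_nil_iff {F : Data} {Φ : CNF} (h : RepCNF F Φ) :
    F = .cons F.hd .nil ↔ Φ.card = 1 := by
  rw [← h.length_toList]
  rcases F with _ | ⟨a, _ | ⟨b, c⟩⟩ <;> simp [Data.toList, Data.hd]

theorem RepCNF.repClause_hd {F : Data} {C : Clause} (h : RepCNF F {C}) : RepClause F.hd C := by
  obtain ⟨L, hn, hC, hL⟩ := h.exists_forall₂
  have hlen := h.length_toList
  rcases F with _ | ⟨a, b⟩
  · simp [Data.toList] at hlen
  · rcases L with _ | ⟨D, L⟩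
    · simp at hC
    · have hD : D ∈ ({C} : CNF) := hC ▸ by simp
      rw [Finset.mem_singleton] at hD
      subst hD
      exact (List.forall₂_cons.1 hL).1

theorem RepCNF.cons {F c : Data} {Φ : CNF} {C : Clause} (h : RepCNF F Φ) (hc : RepClause c C)
    (hC : C ∉ Φ) : RepCNF (.cons c F) (insert C Φ) := by
  obtain ⟨L, hn, rfl, hL⟩ := h.exists_forall₂
  refine ⟨C :: L, List.nodup_cons.2 ⟨by simpa using hC, hn⟩, by simp, repList_iff.2 ?_⟩
  exact List.Forall₂.cons hc hL

section Elimination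

variable {Φ : CNF} {F v : Data} {y : ℕ}

theorem repCNF_posData (hF : RepCNF F Φ) (hv : RepVar v y) :
    RepCNF (posData v F) (Φ.filter fun C => (y, true) ∈ C) :=
  hF.having (repLiteral_litData hv true)

theorem repCNF_negData (hF : RepCNF F Φ) (hv : RepVar v y) (h : IsMU Φ) :
    RepCNF (negData v F) (Φ.filter fun C => (y, false) ∈ C) := by
  have h1 := (hF.lacking (repLiteral_litData hv true)).having (repLiteral_litData hv false)
  rw [Finset.filter_filter] at h1
  rwa [Finset.filter_congr (q := fun C => (y, true) ∉ C ∧ (y, false) ∈ C) fun C hC =>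
    ⟨fun hf => ⟨fun ht => h.not_tautology hC ht hf, hf⟩, And.right⟩]

theorem repCNF_othersData (hF : RepCNF F Φ) {s : ResStep} (hv : RepVar v s.pivot) :
    RepCNF (othersData v F) (s.others Φ) := by
  have h1 := (hF.lacking (repLiteral_litData hv true)).lacking (repLiteral_litData hv false)
  rwa [Finset.filter_filter] at h1

theorem tryEliminate_of_not_occursOnce (hF : RepCNF F Φ) {e O : Data} (hv : RepVar e.hd y)
    (h : IsMU Φ) (ho : ¬ OccursOnce Φ y) : tryEliminate (.cons F O) e = .cons F O := by
  rw [tryEliminate]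
  split
  case isFalse => rfl
  case isTrue hp =>
    split
    case isFalse => rfl
    case isTrue hn =>
      refine absurd (fun b => ?_) ho
      cases b
      · exact (repCNF_negData hF hv h).eq_cons_nil_iff.1 hn
      · exact (repCNF_posData hF hv).eq_cons_nil_iff.1 hp

theorem exists_tryEliminate (hF : RepCNF F Φ) {e O : Data} (hv : RepVar e.hd y) (h : IsMU Φ)
    (ho : OccursOnce Φ y) : ∃ (s : ResStep) (t F' : Data), s.pivot = y ∧
      OnlyIn Φ s.pivot s.left s.right ∧
      tryEliminate (.cons F O) e = .cons F' (.cons t O) ∧ RepStep t s ∧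
      RepCNF F' (s.eliminate Φ) := by
  obtain ⟨C, D, hCD⟩ := ho.exists_onlyIn
  let s : ResStep := ⟨y, C, D⟩
  have hs : OnlyIn Φ s.pivot s.left s.right := hCD
  have hpos := repCNF_posData hF hv
  have hneg := repCNF_negData hF hv h
  have hp := hpos.eq_cons_nil_iff.2 (ho true)
  have hn := hneg.eq_cons_nil_iff.2 (ho false)
  rw [hCD.pos] at hpos
  rw [hCD.neg] at hneg
  have hres : RepClause (resolventData e.hd (posData e.hd F).hd (negData e.hd F).hd) s.resolvent :=
    (hpos.repClause_hd.erase (repLiteral_litData hv true)).union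
      (hneg.repClause_hd.erase (repLiteral_litData hv false))
  exact ⟨s, _, _, rfl, hs, (if_pos hp).trans (if_pos hn),
    ⟨_, _, _, _, rfl, hv, hpos.repClause_hd, hneg.repClause_hd, hres⟩,
    (repCNF_othersData (s := s) hF hv).cons hres (hs.resolvent_notMem h)⟩

end Elimination

/-- The state `s` holds a formula `Ψ` whose refutations, after the recorded steps, refute `Φ`. -/
def IsState (Φ Ψ : CNF) (s : Data) : Prop :=
  IsMUOfDeficiency 1 Ψ ∧ ∃ (F O : Data) (R : List ResStep), s = .cons F O ∧ RepCNF F Ψ ∧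
    List.Forall₂ RepStep O.toList R ∧
    ∀ R', IsVarRORRefutation Ψ R' → IsVarRORRefutation Φ (R.reverse ++ R')

theorem IsState.step {Φ Ψ : CNF} {s e : Data} {y : ℕ} (h : IsState Φ Ψ s)
    (he : RepVar e.hd y) : ∃ Ψ', IsState Φ Ψ' (tryEliminate s e) ∧ vars Ψ' ⊆ vars Ψ ∧
      (Ψ' = Ψ ∧ ¬ OccursOnce Ψ y ∨ vars Ψ' ⊂ vars Ψ) := by
  obtain ⟨hMU, F, O, R, rfl, hF, hO, hR⟩ := h
  by_cases ho : OccursOnce Ψ y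
  · obtain ⟨s, t, F', rfl, hs, heq, ht, hF'⟩ := exists_tryEliminate (O := O) hF he hMU.1 ho
    have hlt : vars (s.eliminate Ψ) ⊂ vars Ψ := by
      rw [hs.vars_eliminate hMU.1]
      exact Finset.erase_ssubset hs.pivot_mem_vars
    refine ⟨_, ⟨hs.isMUOfDeficiency hMU, F', _, s :: R, heq, hF', .cons ht hO, fun R' hR' => ?_⟩,
      hlt.1, .inr hlt⟩
    rw [List.reverse_cons, List.append_assoc]
    exact hR _ (hs.isVarRORRefutation hMU.1 hR')
  · refine ⟨Ψ, ⟨hMU, F, O, R, ?_, hF, hO, hR⟩, subset_rfl, .inl ⟨rfl, ho⟩⟩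
    exact tryEliminate_of_not_occursOnce hF he hMU.1 ho

/-- One round: when a variable that occurred once in each sign at the start is reached, either the
formula has already lost a variable or this one is eliminated now. -/
theorem IsState.foldl {Φ Ψ : CNF} {s : Data} (h : IsState Φ Ψ s) {L : List Data}
    (hL : ∀ e ∈ L, ∃ y, RepVar e.hd y) : ∃ Ψ', IsState Φ Ψ' (L.foldl tryEliminate s) ∧
      vars Ψ' ⊆ vars Ψ ∧
      ∀ e ∈ L, ∀ y, RepVar e.hd y → OccursOnce Ψ y → vars Ψ' ⊂ vars Ψ := by
  induction L generalizing Ψ s with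
  | nil => exact ⟨Ψ, h, subset_rfl, by simp⟩
  | cons e L ih =>
    obtain ⟨y, hy⟩ := hL e List.mem_cons_self
    obtain ⟨Ψ₁, h₁, hs₁, hc⟩ := h.step hy
    obtain ⟨Ψ₂, h₂, hs₂, hlt⟩ := ih h₁ fun x hx => hL x (List.mem_cons_of_mem _ hx)
    refine ⟨Ψ₂, h₂, hs₂.trans hs₁, fun x hx z hz ho => ?_⟩
    rcases hc with ⟨rfl, hno⟩ | hc
    · rcases List.mem_cons.1 hx with rfl | hx
      · exact absurd (hy.inj hz ▸ ho) hno
      · exact hlt x hx z hz ho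
    · exact hs₂.trans_ssubset hc

theorem IsState.foldl_replicate {Φ Ψ : CNF} {s : Data} (h : IsState Φ Ψ s) {L : List Data}
    (hL : ∀ e ∈ L, ∃ y, RepVar e.hd y) (hΨ : ∀ y ∈ vars Ψ, ∃ e ∈ L, RepVar e.hd y) (n : ℕ) :
    ∃ Ψ', IsState Φ Ψ' ((List.replicate n L).flatten.foldl tryEliminate s) ∧
      (vars Ψ').card ≤ (vars Ψ).card - n := by
  induction n generalizing Ψ s with
  | zero => exact ⟨Ψ, h, le_rfl⟩
  | succ n ih =>
    obtain ⟨Ψ₁, h₁, hs₁, hlt⟩ := h.foldl hL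
    obtain ⟨Ψ₂, h₂, hc⟩ := ih h₁ fun y hy => hΨ y (hs₁ hy)
    refine ⟨Ψ₂, ?_, hc.trans ?_⟩
    · rwa [List.replicate_succ, List.flatten_cons, List.foldl_append]
    · rcases (vars Ψ).eq_empty_or_nonempty with he | hne
      · have : vars Ψ₁ = ∅ := Finset.subset_empty.1 (he ▸ hs₁)
        simp [this]
      · obtain ⟨y, hy, ho⟩ := exists_occursOnce h.1 hne
        obtain ⟨e, he, hey⟩ := hΨ y hy
        have := Finset.card_lt_card (hlt e he y hey ho)
        omega

/-! ### The schedule of trials and the final refutation -/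

theorem mem_toList_literalsData {F e : Data} :
    e ∈ (literalsData F).toList ↔ ∃ c ∈ F.toList, e ∈ c.toList := by
  have key : ∀ (L : List Data) (a : Data),
      e ∈ (L.foldl (fun a c => c.appendRev a) a).toList ↔
        (∃ c ∈ L, e ∈ c.toList) ∨ e ∈ a.toList := by
    intro L
    induction L with
    | nil => simp
    | cons c L ih =>
      intro a
      rw [List.foldl_cons, ih, Data.toList_appendRev]
      simp only [List.mem_append, List.mem_reverse, List.mem_cons, exists_eq_or_imp]
      rw [or_left_comm, or_assoc]
  exact (key _ _).trans (by simp [Data.toList])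

theorem toList_schedule (F : Data) : (schedule F).toList =
    (List.replicate F.toList.length (literalsData F).toList.reverse).flatten := by
  have key : ∀ (L : List Data) (X a : Data), (L.foldl (fun a _ => X.appendRev a) a).toList =
      (List.replicate L.length X.toList.reverse).flatten ++ a.toList := by
    intro L
    induction L with
    | nil => simp
    | cons c L ih =>
      intro X a
      rw [List.foldl_cons, ih, Data.toList_appendRev, List.length_cons, List.replicate_succ',
        List.flatten_append]
      simp
  exact (key _ _ _).trans (List.append_nil _)

theorem RepCNF.repVar_of_mem {F e : Data} {Φ : CNF} (h : RepCNF F Φ)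
    (he : e ∈ (literalsData F).toList) : ∃ y, RepVar e.hd y := by
  obtain ⟨L, _, _, hL⟩ := h.exists_forall₂
  obtain ⟨c, hc, hec⟩ := mem_toList_literalsData.1 he
  obtain ⟨C, _, hC⟩ := exists_of_mem_left hL hc
  obtain ⟨M, _, hM⟩ := hC.exists_forall₂
  obtain ⟨l, _, a, b, rfl, ha, _⟩ := exists_of_mem_left hM hec
  exact ⟨_, ha⟩

theorem RepCNF.exists_repVar {F : Data} {Φ : CNF} (h : RepCNF F Φ) {y : ℕ} (hy : y ∈ vars Φ) :
    ∃ e ∈ (literalsData F).toList, RepVar e.hd y := by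
  obtain ⟨L, _, rfl, hL⟩ := h.exists_forall₂
  obtain ⟨C, hC, b, hb⟩ := mem_vars.1 hy
  obtain ⟨c, hc, hcC⟩ := exists_of_mem_right hL (List.mem_toFinset.1 hC)
  obtain ⟨M, rfl, hM⟩ := hcC.exists_forall₂
  obtain ⟨e, he, a, d, rfl, ha, _⟩ := exists_of_mem_right hM (List.mem_toFinset.1 hb)
  exact ⟨_, mem_toList_literalsData.2 ⟨c, hc, he⟩, ha⟩

theorem refutationData_correct {F : Data} {Φ : CNF} (hF : RepCNF F Φ)
    (h : IsMUOfDeficiency 1 Φ) :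
    ∃ R, RepDerivation (refutationData F) R ∧ IsVarRORRefutation Φ R := by
  have h0 : IsState Φ Φ (.cons F .nil) :=
    ⟨h, F, .nil, [], rfl, hF, .nil, fun R' hR' => hR'⟩
  obtain ⟨Ψ, ⟨hΨ, F', O, R, hs, _, hO, hR⟩, hc⟩ := h0.foldl_replicate
    (L := (literalsData F).toList.reverse)
    (fun e he => hF.repVar_of_mem (List.mem_reverse.1 he))
    (fun y hy => (hF.exists_repVar hy).imp fun e he => ⟨List.mem_reverse.2 he.1, he.2⟩)
    F.toList.length
  rw [← toList_schedule] at hs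
  rw [hF.length_toList, h.card_eq] at hc
  -- There are `(vars Φ).card + 1` rounds, one more than suffices.
  have hv : vars Ψ = ∅ := Finset.card_eq_zero.1 (by omega)
  refine ⟨R.reverse, repList_iff.2 ?_, ?_⟩
  · rw [refutationData, hs, Data.toList_appendRev]
    simpa [Data.toList, Data.tl] using hO
  · simpa using hR [] (isVarRORRefutation_nil hΨ.1 hv)

/-- The representation of the formula at the root of a represented tree. -/
theorem PolyTime.exists_root : ∃ f, PolyTime f ∧ ∀ d T, RepTree d T → RepCNF (f d) T.root := by
  classical
  -- A leaf has `nil` as first component, whereas an inner node has there the pair of its variable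
  -- and its formula.
  refine ⟨fun d => if d.hd = .nil then d.tl else d.hd.tl,
    PolyTime.id.hd.ite PolyTime.id.hd.tl PolyTime.id.tl, fun d T h => ?_⟩
  cases T with
  | leaf Φ =>
    obtain ⟨a, rfl, ha⟩ := h
    simpa [Data.hd, Data.tl, SplitTree.root] using ha
  | node Φ x l r =>
    obtain ⟨y, a, b, c, rfl, _, ha, _⟩ := h
    simpa [Data.hd, Data.tl, SplitTree.root] using ha

theorem PolyTime.solvableInPolyTime {f : Data → Data} (hf : PolyTime f) {α β : Type}
    {repIn : Data → α → Prop} {repOut : Data → β → Prop} {Dom : α → Prop} {Sol : α → β → Prop}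
    (h : ∀ d a, repIn d a → Dom a → ∃ b, repOut (f d) b ∧ Sol a b) :
    SolvableInPolyTime repIn repOut Dom Sol := by
  obtain ⟨P, p, hP⟩ := hf
  refine ⟨P, p, fun d a hd ha => ?_⟩
  obtain ⟨t, hr, ht⟩ := hP d
  exact ⟨f d, t, hr, ht, h d a hd ha⟩

end ReadOnce

theorem mainTheorem8 :
    (∀ Φ : ReadOnce.CNF, ReadOnce.IsMUOfDeficiency 1 Φ →
      ReadOnce.VarROR Φ ∧ ∃ T : ReadOnce.SplitTree, ReadOnce.IsCompleteVarDisjunctiveTree Φ T) ∧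
    ReadOnce.SolvableInPolyTime ReadOnce.RepCNF ReadOnce.RepDerivation
      (fun Φ => ReadOnce.IsMUOfDeficiency 1 Φ)
      (fun Φ R => ReadOnce.IsVarRORRefutation Φ R) ∧
    ReadOnce.SolvableInPolyTime ReadOnce.RepTree ReadOnce.RepDerivation
      (fun T => ∃ Φ : ReadOnce.CNF,
        ReadOnce.IsMUOfDeficiency 1 Φ ∧ ReadOnce.IsCompleteVarDisjunctiveTree Φ T)
      (fun T R => ReadOnce.IsVarRORRefutation T.root R) := by
  refine ⟨fun Φ h => ⟨h.varROR, h.exists_tree⟩,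
    ReadOnce.PolyTime.refutationData.solvableInPolyTime fun d Φ hd h =>
      ReadOnce.refutationData_correct hd h, ?_⟩
  obtain ⟨f, hf, hroot⟩ := ReadOnce.PolyTime.exists_root
  refine (ReadOnce.PolyTime.refutationData.comp hf).solvableInPolyTime fun d T hd hT => ?_
  obtain ⟨Φ, hΦ, rfl, _⟩ := hT
  exact ReadOnce.refutationData_correct (hroot d T hd) hΦ
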